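/- Let $(M^n,\bar g)$ be a smooth ($C^\infty$) Riemannian manifold of dimension $n$ with Levi-Civita connection $\bar\nabla$ and curvature tensor $\bar R(X,Y)Z=\bar\nabla_X\bar\nabla_YZ-\bar\nabla_Y\bar\nabla_XZ-\bar\nabla_{[X,Y]}Z$. Let $F^l$ be an $l$-dimensional smooth (immersed) submanifold of $M^n$, and let $\xi$ be a smooth vector field on $M^n$ along $F^l$, that is, a smooth map $\xi:F^l\to TM^n$ with $\xi(p)\in T_pM^n$ for all $p\in F^l$. Equip the tangent bundle $\pi:TM^n\to M^n$ with the Sasaki metric $g_s(\tilde X,\tilde Y)=\bar g(\pi_*\tilde X,\pi_*\tilde Y)+\bar g(K\tilde X,K\tilde Y)$, where $K:TTM^n\to TM^n$ is the connection map of $\bar\nabla$; in the coordinates $(x^a,\xi^a)$ of $TM^n$ induced by coordinates $x^a$ of $M^n$ it is $(K\tilde X)^a=\tilde X^{n+a}+\bar\Gamma^a_{bc}\,\xi^b\tilde X^c$. Let $\tilde\nabla$ be the Levi-Civita connection of $g_s$. The submanifold $\xi(F^l)$ of $TM^n$ is called totally geodesic if $g_s(\tilde\nabla_{\tilde X}\tilde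 Y,\tilde N)=0$ for all vector fields $\tilde X,\tilde Y$ tangent to $\xi(F^l)$ and all vectors $\tilde N$ normal to $\xi(F^l)$. For smooth vector fields $X,Y$ tangent to $F^l$ put $$\nabla^*_XY=\bar\nabla_XY+\tfrac12\big[\bar R(\xi,\bar\nabla_X\xi)Y+\bar R(\xi,\bar\nabla_Y\xi)X\big],$$ a vector field on $M^n$ along $F^l$ (the $\xi$-connection). Then $\xi(F^l)$ is totally geodesic in $TM^n$ with the Sasaki metric if and only if the following two conditions hold: (a) $F^l$ is totally geodesic with respect to the $\xi$-connection, that is, $\nabla^*_XY$ is tangent to $F^l$ for all smooth vector fields $X,Y$ tangent to $F^l$; (b) for all smooth vector fields $X,Y$ tangent to $F^l$, $$\bar\nabla_X\bar\nabla_Y\xi=\bar\nabla_{\nabla^*_XY}\,\xi+\tfrac12\bar R(X,Y)\xi .$$ -/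

import Mathlib

open scoped Manifold ContDiff

noncomputable section

namespace SasakiGeometry

/-- The pull-back `(u, v) ↦ B (A u) (A v)` of a continuous bilinear form by a linear map. -/
def pullbackForm {V W : Type*}
    [AddCommGroup V] [Module ℝ V] [TopologicalSpace V] [IsTopologicalAddGroup V]
    [ContinuousSMul ℝ V]
    [AddCommGroup W] [Module ℝ W] [TopologicalSpace W] [IsTopologicalAddGroup W]
    [ContinuousSMul ℝ W]
    (B : V →L[ℝ] V →L[ℝ] ℝ) (A : W →L[ℝ] V) : W →L[ℝ] W →L[ℝ] ℝ :=
  (A.precomp ℝ).comp (B.comp A)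

theorem pullbackForm_apply {V W : Type*}
    [AddCommGroup V] [Module ℝ V] [TopologicalSpace V] [IsTopologicalAddGroup V]
    [ContinuousSMul ℝ V]
    [AddCommGroup W] [Module ℝ W] [TopologicalSpace W] [IsTopologicalAddGroup W]
    [ContinuousSMul ℝ W]
    (B : V →L[ℝ] V →L[ℝ] ℝ) (A : W →L[ℝ] V) (u v : W) :
    pullbackForm B A u v = B (A u) (A v) := rfl

/-! ### Levi-Civita connection and curvature of a metric, in charts

`N` is a manifold without boundary modelled on the finite-dimensional space `E`, and `g` is a field
of (positive definite, smooth) bilinear forms on its tangent spaces. Mathlib identifies the tangent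
space of `N` at `c` with `E` through the preferred chart at `c`; all the formulas below are the
classical ones in that chart. -/

section Metric

variable {E H : Type*} [NormedAddCommGroup E] [NormedSpace ℝ E] [TopologicalSpace H]
  (I : ModelWithCorners ℝ E H) {N : Type*} [TopologicalSpace N] [ChartedSpace H N]
  [IsManifold I 1 N]
  (g : ∀ x : N, TangentSpace I x →L[ℝ] TangentSpace I x →L[ℝ] ℝ)

/-- The coordinate expression `g_{ab}(y)` of the metric at the point with coordinates `y` in the
preferred chart at `c`. -/
def localMetric (c : N) (y : E) : E →L[ℝ] E →L[ℝ] ℝ :=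
  pullbackForm (g ((extChartAt I c).symm y))
    ((trivializationAt E (TangentSpace I : N → Type _) c).symmL ℝ ((extChartAt I c).symm y))

theorem localMetric_apply (c : N) (y u v : E) :
    localMetric I g c y u v = g ((extChartAt I c).symm y)
      ((trivializationAt E (TangentSpace I : N → Type _) c).symmL ℝ ((extChartAt I c).symm y) u)
      ((trivializationAt E (TangentSpace I : N → Type _) c).symmL ℝ ((extChartAt I c).symm y) v) :=
  rfl

/-- The Christoffel symbols of the first kind, in the preferred chart at `c`, contracted with a
vector `v`:  `(u, w) ↦ (∂_u g(v, w) + ∂_v g(u, w) - ∂_w g(v, u)) / 2`. -/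
def christoffelLower (c : N) (y v : E) : E →L[ℝ] E →L[ℝ] ℝ :=
  let D : E →L[ℝ] E →L[ℝ] E →L[ℝ] ℝ := fderiv ℝ (localMetric I g c) y
  (1 / 2 : ℝ) • (D.flip v + D v - (D.flip v).flip)

theorem christoffelLower_apply (c : N) (y u v w : E) :
    christoffelLower I g c y v u w =
      (1 / 2) * (fderiv ℝ (localMetric I g c) y u v w + fderiv ℝ (localMetric I g c) y v u w
        - fderiv ℝ (localMetric I g c) y w v u) := rfl

/-- The Christoffel symbols of the second kind, in the preferred chart at `c`, contracted with a
vector `v`: the linear map `u ↦ Γ(u, v) = Γ^a_{bc} u^b v^c ∂_a`. The index of the symbols of the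
first kind is raised with the inverse of the metric. -/
def christoffel (c : N) (y v : E) : E →L[ℝ] E :=
  (localMetric I g c y).inverse.comp (christoffelLower I g c y v)

/-- The curvature tensor of the Levi-Civita connection at `c`,
`R(X, Y) Z = ∇_X ∇_Y Z - ∇_Y ∇_X Z - ∇_{[X, Y]} Z`, that is, in coordinates,
`∂_X Γ(Y, Z) - ∂_Y Γ(X, Z) + Γ(X, Γ(Y, Z)) - Γ(Y, Γ(X, Z))`. -/
def curvature (c : N) (X Y Z : TangentSpace I c) : TangentSpace I c :=
  let y₀ : E := extChartAt I c c
  let Γ : E → E → E →L[ℝ] E := fun y v => christoffel I g c y v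
  (fderiv ℝ (fun y => Γ y Z) y₀ X Y - fderiv ℝ (fun y => Γ y Z) y₀ Y X
    + Γ y₀ (Γ y₀ Z Y) X - Γ y₀ (Γ y₀ Z X) Y : E)

variable {E' H' : Type*} [NormedAddCommGroup E'] [NormedSpace ℝ E'] [TopologicalSpace H']
  (J : ModelWithCorners ℝ E' H') {F : Type*} [TopologicalSpace F] [ChartedSpace H' F]
  [IsManifold J 1 F]

/-- The Levi-Civita covariant derivative `∇_u V` of a vector field `V` along a map `h : F → N` in
the direction of a tangent vector `u` of `F` at `p`: in coordinates,
`∂_u V^a + Γ^a_{bc} (∂_u h)^b V^c`. -/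
def covDerivAlong (h : F → N) (V : ∀ q : F, TangentSpace I (h q)) (p : F) :
    TangentSpace J p →L[ℝ] TangentSpace I (h p) :=
  (mvfderiv J (fun q : F =>
      (trivializationAt E (TangentSpace I : N → Type _) (h p) ⟨h q, V q⟩).2) p
    + (christoffel I g (h p) (extChartAt I (h p) (h p)) (V p)).comp (mfderiv J I h p) :
    TangentSpace J p →L[ℝ] E)

/-- Smoothness of a tangent vector field. -/
def IsSmoothField (X : ∀ p : F, TangentSpace J p) : Prop :=
  ContMDiff J J.tangent ∞ (fun p => (⟨p, X p⟩ : TangentBundle J F))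

/-- The submanifold immersed by `h : F → N` is totally geodesic for the Levi-Civita connection of
the metric `g`: for all vector fields `X, Y` tangent to the submanifold and every vector `n` normal
to it, `g (∇_X Y, n) = 0`. -/
def IsTotallyGeodesic (h : F → N) : Prop :=
  ∀ X Y : ∀ p : F, TangentSpace J p, IsSmoothField J X → IsSmoothField J Y →
    ∀ (p : F) (n : TangentSpace I (h p)),
      (∀ u : TangentSpace J p, g (h p) (mfderiv J I h p u) n = 0) →
      g (h p) (covDerivAlong I g J h (fun q => mfderiv J I h q (Y q)) p (X p)) n = 0

/-- For a map `f : F → N`, a vector field `ξ` of `N` along `f` and vector fields `X, Y` tangent to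
`F`: the value at `p` of the derivative for the `ξ`-connection,
`∇*_X Y = ∇_X Y + (R(ξ, ∇_X ξ) Y + R(ξ, ∇_Y ξ) X) / 2`, a vector field of `N` along `f`
(here the tangent vectors of `F` are seen as tangent vectors of `N` through the differential
of `f`). -/
def xiDeriv (f : F → N) (ξ : ∀ p : F, TangentSpace I (f p))
    (X Y : ∀ p : F, TangentSpace J p) (p : F) : TangentSpace I (f p) :=
  covDerivAlong I g J f (fun q => mfderiv J I f q (Y q)) p (X p)
    + (1 / 2 : ℝ) •
      (curvature I g (f p) (ξ p) (covDerivAlong I g J f ξ p (X p)) (mfderiv J I f p (Y p))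
        + curvature I g (f p) (ξ p) (covDerivAlong I g J f ξ p (Y p)) (mfderiv J I f p (X p)))

/-- The submanifold immersed by `f : F → N` is totally geodesic for the `ξ`-connection: for all
vector fields `X, Y` tangent to the submanifold, `∇*_X Y` is tangent to the submanifold. -/
def IsXiTotallyGeodesic (f : F → N) (ξ : ∀ p : F, TangentSpace I (f p)) : Prop :=
  ∀ X Y : ∀ p : F, TangentSpace J p, IsSmoothField J X → IsSmoothField J Y →
    ∀ p : F, ∃ w : TangentSpace J p, mfderiv J I f p w = xiDeriv I g J f ξ X Y p

end Metric

/-! ### The Sasaki metric -/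

section Sasaki

variable {E H : Type*} [NormedAddCommGroup E] [NormedSpace ℝ E] [TopologicalSpace H]
  (I : ModelWithCorners ℝ E H) {M : Type*} [TopologicalSpace M] [ChartedSpace H M]
  [IsManifold I 1 M]
  (g : ∀ x : M, TangentSpace I x →L[ℝ] TangentSpace I x →L[ℝ] ℝ)

/-- The differential `π_* : T_z TM → T_{π z} M` of the projection `π : TM → M`. -/
def projDeriv (z : TangentBundle I M) : TangentSpace I.tangent z →L[ℝ] TangentSpace I z.proj :=
  mfderiv I.tangent I (fun z' : TangentBundle I M => z'.proj) z

/-- The connection map `K : T_z TM → T_{π z} M`: the covariant derivative of the tautological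
vector field `z ↦ z` along the projection `π : TM → M`. In the coordinates `(x, ξ)` of `TM` induced
by a chart of `M` it is `(K X)^a = X^{n+a} + Γ^a_{bc} ξ^b X^c`. -/
def connectionMap (z : TangentBundle I M) :
    TangentSpace I.tangent z →L[ℝ] TangentSpace I z.proj :=
  covDerivAlong I g I.tangent (fun z' : TangentBundle I M => z'.proj) (fun z' => z'.snd) z

/-- The Sasaki metric `g_s(X, Y) = g(π_* X, π_* Y) + g(K X, K Y)` on the tangent bundle. -/
def sasakiMetric (z : TangentBundle I M) :
    TangentSpace I.tangent z →L[ℝ] TangentSpace I.tangent z →L[ℝ] ℝ :=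
  pullbackForm (g z.proj) (projDeriv I z) + pullbackForm (g z.proj) (connectionMap I g z)

theorem sasakiMetric_apply (z : TangentBundle I M) (X Y : TangentSpace I.tangent z) :
    sasakiMetric I g z X Y = g z.proj (projDeriv I z X) (projDeriv I z Y)
      + g z.proj (connectionMap I g z X) (connectionMap I g z Y) := rfl

end Sasaki

end SasakiGeometry

end

/-! At `z = ξ(p)` a vector `U` tangent to `TM` is determined by its horizontal part `π_* U` and its
vertical part `K U`, and the Sasaki metric is the orthogonal sum of two copies of `g` in these
parts. The differential of `ξ` sends `u` to the vector with parts `(f_* u, ∇_u ξ)`. The key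
computation is that the Sasaki covariant derivative of `ξ_* Y` along `ξ_* X` has parts `(∇*_X Y, ∇_X
∇_Y ξ - R(X,Y)ξ / 2)`. Orthogonality to every normal vector means lying in the tangent space, by the
double orthogonal complement in finite dimension. So `ξ(F)` is totally geodesic exactly when some
`w` satisfies `f_* w = ∇*_X Y` and `∇_w ξ = ∇_X ∇_Y ξ - R(X,Y)ξ / 2`. The first equation is (a);
since an immersion makes `w` unique, the second is (b).

The key computation is the Koszul formula in a chart (`flatSasaki_christoffel`). Differentiating the
Sasaki metric produces derivatives of the connection map `K`, and their antisymmetric part is the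
curvature (`flatConnector_swap`). The pair symmetry `curvature_pair` then frees the test vector from
the curvature and yields the terms `R(ξ, ∇ξ)` of the `ξ`-connection.

Passing to manifolds requires care because each covariant derivative is defined in the preferred
chart at its own base point. Iterated derivatives need one fixed chart, and `coord_covDerivAlong`
supplies it through the transformation law `christoffel_pullback`. `localMetric_sasaki` identifies
the Sasaki metric on a whole chart, so its Christoffel symbols are those of the coordinate model.
`sasakiMetric_covDerivAlong` assembles the two parts, and `exists_eq_iff_orthogonal` does the linear
algebra. -/

noncomputable section

namespace SasakiGeometry

/-! ### Metrics on open subsets of a vector space -/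

section Flat

open ContinuousLinearMap Filter Topology

set_option maxSynthPendingDepth 3

variable {E : Type*} [NormedAddCommGroup E] [NormedSpace ℝ E]

/-- The Christoffel symbols of the first kind of a metric with derivative `D`. -/
def flatLower (D : E →L[ℝ] E →L[ℝ] E →L[ℝ] ℝ) : E →L[ℝ] E →L[ℝ] E →L[ℝ] ℝ :=
  (1 / 2 : ℝ) • (D.flip + D - ((flipₗᵢ ℝ E E ℝ).toContinuousLinearEquiv :
    (E →L[ℝ] E →L[ℝ] ℝ) →L[ℝ] (E →L[ℝ] E →L[ℝ] ℝ)).comp D.flip)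

theorem flatLower_apply (D : E →L[ℝ] E →L[ℝ] E →L[ℝ] ℝ) (u v w : E) :
    flatLower D v u w = (1 / 2) * (D u v w + D v u w - D w v u) := rfl

/-- The Christoffel symbols of the second kind of a metric `B` on a vector space. -/
def flatChristoffel (B : E → E →L[ℝ] E →L[ℝ] ℝ) (y : E) : E →L[ℝ] E →L[ℝ] E :=
  (compL ℝ E (E →L[ℝ] ℝ) E (B y).inverse).comp (flatLower (fderiv ℝ B y))

/-- The curvature tensor of a metric `B` on a vector space. -/
def flatCurvature (B : E → E →L[ℝ] E →L[ℝ] ℝ) (y X Y Z : E) : E :=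
  fderiv ℝ (flatChristoffel B) y X Z Y - fderiv ℝ (flatChristoffel B) y Y Z X
    + flatChristoffel B y (flatChristoffel B y Z Y) X
    - flatChristoffel B y (flatChristoffel B y Z X) Y

/-- `B` is a smooth metric on the open set `U`. -/
structure IsMetricOn (B : E → E →L[ℝ] E →L[ℝ] ℝ) (U : Set E) : Prop where
  isOpen : IsOpen U
  contDiffOn : ContDiffOn ℝ ∞ B U
  symm : ∀ y ∈ U, ∀ u v, B y u v = B y v u
  pos : ∀ y ∈ U, ∀ u, u ≠ 0 → 0 < B y u u

/-- Positivity gives injectivity, and `E` and its dual have equal dimension. Since `inverse` is zero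
on non-invertible maps, this is what gives meaning to raising the index in `flatChristoffel`. -/
theorem isInvertible_of_pos [FiniteDimensional ℝ E] {A : E →L[ℝ] E →L[ℝ] ℝ}
    (h : ∀ u, u ≠ 0 → 0 < A u u) : A.IsInvertible := by
  have hinj : Function.Injective A.toLinearMap := by
    rw [← LinearMap.ker_eq_bot, LinearMap.ker_eq_bot']
    intro u hu
    by_contra hne
    have h1 := h u hne
    have h2 : A u = 0 := hu
    simp [h2] at h1
  have hfin : Module.finrank ℝ E = Module.finrank ℝ (E →L[ℝ] ℝ) := by
    rw [← (LinearMap.toContinuousLinearMap : (E →ₗ[ℝ] ℝ) ≃ₗ[ℝ] _).finrank_eq]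
    exact (Subspace.dual_finrank_eq (K := ℝ) (V := E)).symm
  refine ⟨(LinearEquiv.ofInjectiveOfFinrankEq A.toLinearMap hinj hfin).toContinuousLinearEquiv, ?_⟩
  ext u
  rfl

theorem apply_flatChristoffel {B : E → E →L[ℝ] E →L[ℝ] ℝ} {y : E} (h : (B y).IsInvertible)
    (u v w : E) : B y (flatChristoffel B y v u) w =
      (1 / 2) * (fderiv ℝ B y u v w + fderiv ℝ B y v u w - fderiv ℝ B y w v u) := by
  rw [← flatLower_apply]
  have : B y ((B y).inverse (flatLower (fderiv ℝ B y) v u)) = flatLower (fderiv ℝ B y) v u := by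
    obtain ⟨e, he⟩ := h
    rw [← he, ContinuousLinearMap.inverse_equiv]
    simp
  exact congrArg (fun L : E →L[ℝ] ℝ => L w) this

theorem fderiv_symm {B : E → E →L[ℝ] E →L[ℝ] ℝ} {y : E} (hd : DifferentiableAt ℝ B y)
    (h : ∀ᶠ z in 𝓝 y, ∀ u v, B z u v = B z v u) (c u v : E) :
    fderiv ℝ B y c u v = fderiv ℝ B y c v u := by
  have h1 (u v : E) : HasFDerivAt (fun z => B z u v) ((fderiv ℝ B y).flip u |>.flip v) y := by
    have := (hd.hasFDerivAt.clm_apply (hasFDerivAt_const u y)).clm_apply (hasFDerivAt_const v y)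
    refine this.congr_fderiv ?_
    ext; simp
  have h2 := (h1 u v).unique ((h1 v u).congr_of_eventuallyEq (h.mono fun z hz => hz u v))
  exact congrArg (fun L : E →L[ℝ] ℝ => L c) h2

theorem flatCurvature_swap (B : E → E →L[ℝ] E →L[ℝ] ℝ) (X Y Z : E) (y : E) :
    flatCurvature B y X Y Z = -flatCurvature B y Y X Z := by
  unfold flatCurvature; abel

namespace IsMetricOn

variable {B : E → E →L[ℝ] E →L[ℝ] ℝ} {U : Set E}

theorem contDiffAt (h : IsMetricOn B U) {y : E} (hy : y ∈ U) : ContDiffAt ℝ ∞ B y :=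
  h.contDiffOn.contDiffAt (h.isOpen.mem_nhds hy)

theorem differentiableAt (h : IsMetricOn B U) {y : E} (hy : y ∈ U) : DifferentiableAt ℝ B y :=
  (h.contDiffAt hy).differentiableAt (by simp)

theorem contDiffAt_fderiv (h : IsMetricOn B U) {y : E} (hy : y ∈ U) :
    ContDiffAt ℝ ∞ (fderiv ℝ B) y :=
  (h.contDiffAt hy).fderiv_right (by simp)

theorem fderiv_symm (h : IsMetricOn B U) {y : E} (hy : y ∈ U) (c u v : E) :
    fderiv ℝ B y c u v = fderiv ℝ B y c v u :=
  SasakiGeometry.fderiv_symm (h.differentiableAt hy)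
    (Filter.mem_of_superset (h.isOpen.mem_nhds hy) fun z hz => h.symm z hz) c u v

theorem ext_apply (h : IsMetricOn B U) {y : E} (hy : y ∈ U) {u v : E}
    (huv : ∀ w, B y u w = B y v w) : u = v := by
  by_contra hne
  have h1 := h.pos y hy (u - v) (sub_ne_zero.2 hne)
  simp [huv] at h1

theorem fderiv_fderiv_comm (h : IsMetricOn B U) {y : E} (hy : y ∈ U) (d c : E) :
    fderiv ℝ (fderiv ℝ B) y d c = fderiv ℝ (fderiv ℝ B) y c d :=
  ((h.contDiffAt hy).isSymmSndFDerivAt (by simpa using (ENat.LEInfty.out : (2 : WithTop ℕ∞) ≤ ∞))).eq d c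

variable [FiniteDimensional ℝ E]

theorem isInvertible (h : IsMetricOn B U) {y : E} (hy : y ∈ U) : (B y).IsInvertible :=
  isInvertible_of_pos (h.pos y hy)

theorem apply_christoffel (h : IsMetricOn B U) {y : E} (hy : y ∈ U) (u v w : E) :
    B y (flatChristoffel B y v u) w =
      (1 / 2) * (fderiv ℝ B y u v w + fderiv ℝ B y v u w - fderiv ℝ B y w v u) :=
  apply_flatChristoffel (h.isInvertible hy) u v w

theorem christoffel_symm (h : IsMetricOn B U) {y : E} (hy : y ∈ U) (u v : E) :
    flatChristoffel B y v u = flatChristoffel B y u v := by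
  refine h.ext_apply hy fun w => ?_
  rw [h.apply_christoffel hy, h.apply_christoffel hy, h.fderiv_symm hy w u v]
  ring

/-- Metric compatibility, `∇g = 0`: in the sum of the two Koszul expressions all derivatives cancel
except the one in direction `c`. -/
theorem fderiv_eq (h : IsMetricOn B U) {y : E} (hy : y ∈ U) (c u v : E) :
    fderiv ℝ B y c u v = B y (flatChristoffel B y c u) v + B y u (flatChristoffel B y c v) := by
  rw [h.symm y hy u, h.apply_christoffel hy, h.apply_christoffel hy, h.fderiv_symm hy c u v,
    h.fderiv_symm hy u c v, h.fderiv_symm hy v c u]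
  ring

theorem contDiffAt_christoffel (h : IsMetricOn B U) {y : E} (hy : y ∈ U) :
    ContDiffAt ℝ ∞ (flatChristoffel B) y := by
  have h1 : ContDiffAt ℝ ∞ (fun y => (B y).inverse) y :=
    ((h.isInvertible hy).contDiffAt_map_inverse).comp y (h.contDiffAt hy)
  have h2 : ContDiffAt ℝ ∞ (fun y => flatLower (fderiv ℝ B y)) y := by
    have hD := h.contDiffAt_fderiv hy
    have hf : ContDiffAt ℝ ∞ (fun y => (fderiv ℝ B y).flip) y :=
      (flipₗᵢ ℝ E E (E →L[ℝ] ℝ)).contDiff.contDiffAt.comp y hD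
    exact ((hf.add hD).sub (contDiffAt_const.clm_comp hf)).const_smul _
  exact ((compL ℝ E (E →L[ℝ] ℝ) E).contDiff.contDiffAt.comp y h1).clm_comp h2

theorem differentiableAt_christoffel (h : IsMetricOn B U) {y : E} (hy : y ∈ U) :
    DifferentiableAt ℝ (flatChristoffel B) y :=
  (h.contDiffAt_christoffel hy).differentiableAt (by simp)

theorem fderiv_christoffel_symm (h : IsMetricOn B U) {y : E} (hy : y ∈ U) (c u v : E) :
    fderiv ℝ (flatChristoffel B) y c u v = fderiv ℝ (flatChristoffel B) y c v u := by
  have hd := h.differentiableAt_christoffel hy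
  have h1 (u v : E) : HasFDerivAt (fun z => flatChristoffel B z u v)
      ((fderiv ℝ (flatChristoffel B) y).flip u |>.flip v) y := by
    have := (hd.hasFDerivAt.clm_apply (hasFDerivAt_const u y)).clm_apply (hasFDerivAt_const v y)
    refine this.congr_fderiv ?_
    ext; simp
  have h2 := (h1 u v).unique ((h1 v u).congr_of_eventuallyEq
    (Filter.mem_of_superset (h.isOpen.mem_nhds hy) fun z hz => h.christoffel_symm hz v u))
  exact congrArg (fun L : E →L[ℝ] E => L c) h2

/-- Metric compatibility differentiated once more. Comparing the two orders of differentiation turns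
the symmetry of second derivatives into the skewness of the curvature. -/
theorem fderiv_fderiv_eq (h : IsMetricOn B U) {y : E} (hy : y ∈ U) (d c u v : E) :
    fderiv ℝ (fderiv ℝ B) y d c u v =
      fderiv ℝ B y d (flatChristoffel B y c u) v
        + B y (fderiv ℝ (flatChristoffel B) y d c u) v
        + fderiv ℝ B y d u (flatChristoffel B y c v)
        + B y u (fderiv ℝ (flatChristoffel B) y d c v) := by
  have hB := (h.differentiableAt hy).hasFDerivAt
  have hG := (h.differentiableAt_christoffel hy).hasFDerivAt
  have hD := ((h.contDiffAt_fderiv hy).differentiableAt (by simp)).hasFDerivAt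
  have k (w : E) := hasFDerivAt_const (𝕜 := ℝ) w y
  have e1 := ((hD.clm_apply (k c)).clm_apply (k u)).clm_apply (k v)
  have e2 := ((hB.clm_apply ((hG.clm_apply (k c)).clm_apply (k u))).clm_apply (k v)).add
    ((hB.clm_apply (k u)).clm_apply ((hG.clm_apply (k c)).clm_apply (k v)))
  have e3 := e1.unique (e2.congr_of_eventuallyEq
    (Filter.mem_of_superset (h.isOpen.mem_nhds hy) fun z hz => h.fderiv_eq hz c u v))
  have e4 := congrArg (fun L : E →L[ℝ] ℝ => L d) e3
  simp at e4
  linarith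

/-- Absence of torsion: with `Γ` symmetric in its arguments, the terms of the cyclic sum cancel in
pairs. -/
theorem curvature_bianchi (h : IsMetricOn B U) {y : E} (hy : y ∈ U) (X Y Z : E) :
    flatCurvature B y X Y Z + flatCurvature B y Y Z X + flatCurvature B y Z X Y = 0 := by
  unfold flatCurvature
  rw [h.fderiv_christoffel_symm hy X Z Y, h.fderiv_christoffel_symm hy Y X Z,
    h.fderiv_christoffel_symm hy Z Y X, h.christoffel_symm hy X Z, h.christoffel_symm hy Y X,
    h.christoffel_symm hy Z Y]
  abel

theorem curvature_skew (h : IsMetricOn B U) {y : E} (hy : y ∈ U) (X Y Z W : E) :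
    B y (flatCurvature B y X Y Z) W = -B y (flatCurvature B y X Y W) Z := by
  have e1 := h.fderiv_fderiv_eq hy X Y Z W
  have e2 := h.fderiv_fderiv_eq hy Y X Z W
  rw [h.fderiv_fderiv_comm hy Y X, e1] at e2
  simp only [h.fderiv_eq hy] at e2
  unfold flatCurvature
  rw [h.christoffel_symm hy Y Z, h.christoffel_symm hy X Z, h.christoffel_symm hy Y W,
    h.christoffel_symm hy X W, h.christoffel_symm hy X (flatChristoffel B y Y Z),
    h.christoffel_symm hy Y (flatChristoffel B y X Z),
    h.christoffel_symm hy X (flatChristoffel B y Y W),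
    h.christoffel_symm hy Y (flatChristoffel B y X W),
    h.fderiv_christoffel_symm hy X Z Y, h.fderiv_christoffel_symm hy Y Z X,
    h.fderiv_christoffel_symm hy X W Y, h.fderiv_christoffel_symm hy Y W X]
  simp only [map_add, map_sub, add_apply, sub_apply]
  have s := h.symm y hy
  rw [s Z, s Z, s Z, s Z] at e2
  linarith

/-- The classical octahedron argument: add the Bianchi identities for the four cyclic shifts of `X,
Y, Z, W` and cancel by skewness in the first and in the last pair. -/
theorem curvature_pair (h : IsMetricOn B U) {y : E} (hy : y ∈ U) (X Y Z W : E) :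
    B y (flatCurvature B y X Y Z) W = B y (flatCurvature B y Z W X) Y := by
  have b (X Y Z W : E) : B y (flatCurvature B y X Y Z) W + B y (flatCurvature B y Y Z X) W
      + B y (flatCurvature B y Z X Y) W = 0 := by
    have := congrArg (fun v => B y v W) (h.curvature_bianchi hy X Y Z)
    simpa using this
  have a (X Y Z W : E) : B y (flatCurvature B y X Y Z) W = -B y (flatCurvature B y Y X Z) W := by
    rw [flatCurvature_swap]; simp
  have s := h.curvature_skew hy
  linarith [b X Y Z W, b Y Z W X, b Z W X Y, b W X Y Z, s X Y Z W, s Y Z X W, s Z X Y W,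
    s Y Z W X, s Z W Y X, s W Y Z X, s Z W X Y, s W X Z Y, s X Z W Y, s W X Y Z, s X Y W Z,
    s Y W X Z, a X Y Z W, a Y Z X W, a Z X Y W, a Y Z W X, a Z W Y X, a W Y Z X,
    a Z W X Y, a W X Z Y, a X Z W Y, a W X Y Z, a X Y W Z, a Y W X Z]

/-- The transformation law of the Christoffel symbols under a change of coordinates `τ`. -/
theorem christoffel_pullback {B' : E → E →L[ℝ] E →L[ℝ] ℝ} {U' : Set E} (h : IsMetricOn B U)
    (h' : IsMetricOn B' U') {τ : E → E} {y : E} (hy : y ∈ U) (hy' : τ y ∈ U')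
    (hτ : ContDiffAt ℝ 2 τ y) (hinv : Function.Surjective (fderiv ℝ τ y))
    (heq : ∀ᶠ z in 𝓝 y, ∀ u v, B z u v = B' (τ z) (fderiv ℝ τ z u) (fderiv ℝ τ z v))
    (u v : E) :
    fderiv ℝ τ y (flatChristoffel B y v u) = fderiv ℝ (fderiv ℝ τ) y u v
      + flatChristoffel B' (τ y) (fderiv ℝ τ y v) (fderiv ℝ τ y u) := by
  have hT := (hτ.differentiableAt (by simp)).hasFDerivAt
  have hT2 := ((hτ.fderiv_right (m := 1) (by norm_num)).differentiableAt (by simp)).hasFDerivAt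
  have hB' := (h'.differentiableAt hy').hasFDerivAt.comp y hT
  have hB := (h.differentiableAt hy).hasFDerivAt
  have k (w : E) := hasFDerivAt_const (𝕜 := ℝ) w y
  have D (c u v : E) : fderiv ℝ B y c u v =
      fderiv ℝ B' (τ y) (fderiv ℝ τ y c) (fderiv ℝ τ y u) (fderiv ℝ τ y v)
      + B' (τ y) (fderiv ℝ (fderiv ℝ τ) y c u) (fderiv ℝ τ y v)
      + B' (τ y) (fderiv ℝ τ y u) (fderiv ℝ (fderiv ℝ τ) y c v) := by
    have e1 := (hB.clm_apply (k u)).clm_apply (k v)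
    have e2 := (hB'.clm_apply (hT2.clm_apply (k u))).clm_apply (hT2.clm_apply (k v))
    have e3 := e1.unique (e2.congr_of_eventuallyEq (heq.mono fun z hz => hz u v))
    have e4 := congrArg (fun L : E →L[ℝ] ℝ => L c) e3
    simp at e4
    linarith
  have hs (a b : E) : fderiv ℝ (fderiv ℝ τ) y a b = fderiv ℝ (fderiv ℝ τ) y b a :=
    (hτ.isSymmSndFDerivAt (by simp)).eq a b
  -- Nondegeneracy of `B'` allows testing against vectors. By surjectivity these have the form `dτ
  -- w`, so both sides become Koszul expressions.
  refine h'.ext_apply hy' fun w' => ?_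
  obtain ⟨w, rfl⟩ := hinv w'
  rw [← heq.self_of_nhds, h.apply_christoffel hy, map_add, add_apply, h'.apply_christoffel hy',
    D, D, D, hs w u, hs w v, hs v u]
  simp only [h'.symm (τ y) hy' (fderiv ℝ τ y v), h'.symm (τ y) hy' (fderiv ℝ τ y u)]
  ring

end IsMetricOn

/-- The Sasaki metric in coordinates. -/
def flatSasaki (B : E → E →L[ℝ] E →L[ℝ] ℝ) (z : E × E) : E × E →L[ℝ] E × E →L[ℝ] ℝ :=
  pullbackForm (B z.1) (fst ℝ E E)
    + pullbackForm (B z.1) (snd ℝ E E + (flatChristoffel B z.1 z.2).comp (fst ℝ E E))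

theorem flatSasaki_apply (B : E → E →L[ℝ] E →L[ℝ] ℝ) (z a b : E × E) :
    flatSasaki B z a b = B z.1 a.1 b.1
      + B z.1 (a.2 + flatChristoffel B z.1 z.2 a.1) (b.2 + flatChristoffel B z.1 z.2 b.1) := rfl

/-- The structure equation of the connection map: exchanging the direction of differentiation `(u,
u')` of `K` with the argument `(w, w')` costs the curvature `R(u, w)η`, up to Christoffel terms in
the vertical parts. -/
theorem flatConnector_swap (B : E → E →L[ℝ] E →L[ℝ] ℝ) (y η u u' w w' : E) :
    fderiv ℝ (flatChristoffel B) y u η w + flatChristoffel B y u' w =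
      fderiv ℝ (flatChristoffel B) y w η u + flatChristoffel B y w' u + flatCurvature B y u w η
        + flatChristoffel B y (u' + flatChristoffel B y η u) w
        - flatChristoffel B y (w' + flatChristoffel B y η w) u := by
  simp only [flatCurvature, map_add, add_apply]
  abel

namespace IsMetricOn

variable {B : E → E →L[ℝ] E →L[ℝ] ℝ} {U : Set E}

theorem flatSasaki_pos (h : IsMetricOn B U) {z : E × E} (hz : z.1 ∈ U) (a : E × E) (ha : a ≠ 0) :
    0 < flatSasaki B z a a := by
  have hnn (u : E) : 0 ≤ B z.1 u u := by
    rcases eq_or_ne u 0 with rfl | hu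
    · simp
    · exact (h.pos _ hz u hu).le
  rw [flatSasaki_apply]
  by_cases h1 : a.1 = 0
  · have h2 : a.2 ≠ 0 := fun h2 => ha (Prod.ext h1 h2)
    simpa [h1] using h.pos _ hz _ h2
  · exact add_pos_of_pos_of_nonneg (h.pos _ hz _ h1) (hnn _)

variable [FiniteDimensional ℝ E]

/-- Together with positivity, first-order differentiability is all that the Koszul formula for the
Sasaki metric needs. -/
theorem differentiableAt_flatSasaki (h : IsMetricOn B U) {z : E × E} (hz : z.1 ∈ U) :
    DifferentiableAt ℝ (flatSasaki B) z := by
  have hB : DifferentiableAt ℝ (fun z : E × E => B z.1) z :=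
    (h.differentiableAt hz).comp z differentiableAt_fst
  have hG : DifferentiableAt ℝ (fun z : E × E => flatChristoffel B z.1) z :=
    (h.differentiableAt_christoffel hz).comp z differentiableAt_fst
  have hK : DifferentiableAt ℝ (fun z : E × E =>
      snd ℝ E E + (flatChristoffel B z.1 z.2).comp (fst ℝ E E)) z :=
    (differentiableAt_const _).add
      ((hG.clm_apply differentiableAt_snd).clm_comp (differentiableAt_const _))
  have hP : DifferentiableAt ℝ (fun z : E × E =>
      (snd ℝ E E + (flatChristoffel B z.1 z.2).comp (fst ℝ E E)).precomp ℝ) z :=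
    ((compL ℝ (E × E) E ℝ).flip.differentiableAt).comp z hK
  exact ((differentiableAt_const _).clm_comp (hB.clm_comp (differentiableAt_const _))).add
    (hP.clm_comp (hB.clm_comp hK))

theorem fderiv_flatSasaki (h : IsMetricOn B U) {z : E × E} (hz : z.1 ∈ U) (c a b : E × E) :
    fderiv ℝ (flatSasaki B) z c a b =
      fderiv ℝ B z.1 c.1 a.1 b.1
      + fderiv ℝ B z.1 c.1 (a.2 + flatChristoffel B z.1 z.2 a.1)
          (b.2 + flatChristoffel B z.1 z.2 b.1)
      + B z.1 (fderiv ℝ (flatChristoffel B) z.1 c.1 z.2 a.1 + flatChristoffel B z.1 c.2 a.1)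
          (b.2 + flatChristoffel B z.1 z.2 b.1)
      + B z.1 (a.2 + flatChristoffel B z.1 z.2 a.1)
          (fderiv ℝ (flatChristoffel B) z.1 c.1 z.2 b.1 + flatChristoffel B z.1 c.2 b.1) := by
  have hB := (h.differentiableAt hz).hasFDerivAt.comp z hasFDerivAt_fst
  have hG := (h.differentiableAt_christoffel hz).hasFDerivAt.comp z hasFDerivAt_fst
  have k (w : E) := hasFDerivAt_const (𝕜 := ℝ) w z
  have hK (a : E × E) := (k a.2).add ((hG.clm_apply hasFDerivAt_snd).clm_apply (k a.1))
  have e1 := ((hB.clm_apply (k a.1)).clm_apply (k b.1)).add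
    ((hB.clm_apply (hK a)).clm_apply (hK b))
  have e2 := ((h.differentiableAt_flatSasaki hz).hasFDerivAt.clm_apply
    (hasFDerivAt_const a z)).clm_apply (hasFDerivAt_const b z)
  have e4 := congrArg (fun L : E × E →L[ℝ] ℝ => L c) (e2.unique e1)
  simp at e4
  rw [e4]
  simp only [map_add, add_apply]
  ring

/-- The Levi-Civita connection of the Sasaki metric in coordinates. -/
theorem flatSasaki_christoffel (h : IsMetricOn B U) {z : E × E} (hz : z.1 ∈ U)
    (u v w : E × E) :
    flatSasaki B z (flatChristoffel (flatSasaki B) z v u) w =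
      B z.1 (flatChristoffel B z.1 v.1 u.1
        + (1 / 2 : ℝ) • (flatCurvature B z.1 z.2 (u.2 + flatChristoffel B z.1 z.2 u.1) v.1
          + flatCurvature B z.1 z.2 (v.2 + flatChristoffel B z.1 z.2 v.1) u.1)) w.1
      + B z.1 (flatChristoffel B z.1 (v.2 + flatChristoffel B z.1 z.2 v.1) u.1
          + (fderiv ℝ (flatChristoffel B) z.1 u.1 z.2 v.1 + flatChristoffel B z.1 u.2 v.1)
          - (1 / 2 : ℝ) • flatCurvature B z.1 u.1 v.1 z.2)
        (w.2 + flatChristoffel B z.1 z.2 w.1) := by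
  rw [apply_flatChristoffel (isInvertible_of_pos (h.flatSasaki_pos hz)), h.fderiv_flatSasaki hz,
    h.fderiv_flatSasaki hz, h.fderiv_flatSasaki hz]
  obtain ⟨y, η⟩ := z
  obtain ⟨u, u'⟩ := u
  obtain ⟨v, v'⟩ := v
  obtain ⟨w, w'⟩ := w
  dsimp only at hz ⊢
  have e1 := flatConnector_swap B y η u u' w w'
  have e2 := flatConnector_swap B y η v v' w w'
  have e3 := flatConnector_swap B y η v v' u u'
  rw [flatCurvature_swap] at e3
  -- The vertical parts become opaque, so that additivity does not break them up again.
  obtain ⟨Ku, hu⟩ : ∃ K, K = u' + flatChristoffel B y η u := ⟨_, rfl⟩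
  obtain ⟨Kv, hv⟩ : ∃ K, K = v' + flatChristoffel B y η v := ⟨_, rfl⟩
  obtain ⟨Kw, hw⟩ : ∃ K, K = w' + flatChristoffel B y η w := ⟨_, rfl⟩
  rw [← hu, ← hv, ← hw]
  rw [← hu, ← hw] at e1
  rw [← hv, ← hw] at e2
  rw [← hv, ← hu] at e3
  have s := h.symm y hz
  have k := h.christoffel_symm hz
  have e1' := congrArg (fun a => B y a Kv) e1
  have e2' := congrArg (fun a => B y a Ku) e2
  have e3' := congrArg (fun a => B y a Kw) e3
  have p1 := h.curvature_pair hz u w η Kv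
  have p2 := h.curvature_pair hz v w η Ku
  simp only [map_add, map_sub, map_neg, map_smul, add_apply, sub_apply, neg_apply, smul_apply,
    smul_eq_mul] at e1' e2' e3' ⊢
  simp only [h.fderiv_eq hz]
  -- Symmetry of `Γ` and of `B`, in chosen orientations only, puts all terms in a common form. What
  -- remains is linear: `e1'` and `e2'` trade derivatives in direction `w` for curvature, `e3'`
  -- gives `-R(u, v)η / 2`, and `p1`, `p2` move `w` out of the curvature.
  simp only [k Ku v, k Kv u, k Kw u, k Kw v, k Ku w, k Kv w, k u v, k u w, k v w,
    s Ku, s Kv, s u, s v]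
  linarith

end IsMetricOn

end Flat

/-! ### Derivatives of vector-valued maps on manifolds -/

section VectorValued

open Filter Topology

variable {E' H' : Type*} [NormedAddCommGroup E'] [NormedSpace ℝ E'] [TopologicalSpace H']
  {J : ModelWithCorners ℝ E' H'} {F : Type*} [TopologicalSpace F] [ChartedSpace H' F]
  {V W : Type*} [NormedAddCommGroup V] [NormedSpace ℝ V] [NormedAddCommGroup W] [NormedSpace ℝ W]

theorem mvfderiv_congr {a b : F → V} {p : F} (h : a =ᶠ[𝓝 p] b) :
    mvfderiv J a p = mvfderiv J b p := by
  have := h.mfderiv_eq (I := J) (I' := 𝓘(ℝ, V))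
  ext u
  exact congrArg (fun L : E' →L[ℝ] V => L u) this

theorem mvfderiv_fderiv {Φ : V → W} {a : F → V} {p : F} (hΦ : DifferentiableAt ℝ Φ (a p))
    (ha : MDifferentiableAt J 𝓘(ℝ, V) a p) (u : TangentSpace J p) :
    mvfderiv J (fun q => Φ (a q)) p u = fderiv ℝ Φ (a p) (mvfderiv J a p u) := by
  have := mfderiv_comp_apply p hΦ.mdifferentiableAt ha u
  rw [mfderiv_eq_fderiv] at this
  exact this

theorem mvfderiv_prodMk {a : F → V} {b : F → W} {p : F} (ha : MDifferentiableAt J 𝓘(ℝ, V) a p)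
    (hb : MDifferentiableAt J 𝓘(ℝ, W) b p) (u : TangentSpace J p) :
    mvfderiv J (fun q => (a q, b q)) p u = (mvfderiv J a p u, mvfderiv J b p u) := by
  have h1 := mvfderiv_fderiv (Φ := Prod.fst) differentiableAt_fst (ha.prodMk_space hb) u
  have h2 := mvfderiv_fderiv (Φ := Prod.snd) differentiableAt_snd (ha.prodMk_space hb) u
  rw [fderiv_fst] at h1
  rw [fderiv_snd] at h2
  exact Prod.ext h1.symm h2.symm

theorem mvfderiv_clm_apply {A : F → V →L[ℝ] W} {b : F → V} {p : F}
    (hA : MDifferentiableAt J 𝓘(ℝ, V →L[ℝ] W) A p) (hb : MDifferentiableAt J 𝓘(ℝ, V) b p)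
    (u : TangentSpace J p) :
    mvfderiv J (fun q => A q (b q)) p u
      = A p (mvfderiv J b p u) + mvfderiv J A p u (b p) := by
  have h1 : HasFDerivAt (fun z : (V →L[ℝ] W) × V => z.1 z.2) _ (A p, b p) :=
    hasFDerivAt_fst.clm_apply hasFDerivAt_snd
  have h2 := mvfderiv_fderiv (J := J) (a := fun q => (A q, b q)) h1.differentiableAt
    (hA.prodMk_space hb) u
  rw [h1.fderiv, mvfderiv_prodMk hA hb] at h2
  simpa using h2

theorem mvfderiv_add {a b : F → V} {p : F}
    (ha : MDifferentiableAt J 𝓘(ℝ, V) a p) (hb : MDifferentiableAt J 𝓘(ℝ, V) b p)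
    (u : TangentSpace J p) :
    mvfderiv J (fun q => a q + b q) p u = mvfderiv J a p u + mvfderiv J b p u := by
  rw [_root_.mvfderiv_fun_add ha hb]; rfl

end VectorValued

/-! ### The tangent bundle in the preferred charts -/

section Charts

open Filter Topology

variable {E H : Type*} [NormedAddCommGroup E] [NormedSpace ℝ E] [TopologicalSpace H]
  {I : ModelWithCorners ℝ E H} {N : Type*} [TopologicalSpace N] [ChartedSpace H N]

section

variable [IsManifold I 1 N]

variable (I) in
/-- The components of a tangent vector in the preferred chart at `c`. -/
def coord (c : N) (z : TangentBundle I N) : E :=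
  (trivializationAt E (TangentSpace I : N → Type _) c z).2

theorem coord_self (x : N) (v : TangentSpace I x) : coord I x ⟨x, v⟩ = v :=
  tangentCoordChange_self (mem_extChartAt_source x)

theorem coord_eq_mfderiv {c x : N} (hx : x ∈ (chartAt H c).source) (v : TangentSpace I x) :
    coord I c ⟨x, v⟩ = mfderiv I 𝓘(ℝ, E) (extChartAt I c) x v := by
  have h1 : coord I c ⟨x, v⟩ = (trivializationAt E (TangentSpace I : N → Type _)
      c).continuousLinearMapAt ℝ x v := by
    rw [Bundle.Trivialization.continuousLinearMapAt_apply,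
      Bundle.Trivialization.coe_linearMapAt_of_mem _ (by simpa using hx)]
    rfl
  rw [h1, TangentBundle.continuousLinearMapAt_trivializationAt hx]
  rfl

theorem coord_symmL {c x : N} (hx : x ∈ (chartAt H c).source) (u : E) :
    coord I c ⟨x, (trivializationAt E (TangentSpace I : N → Type _) c).symmL ℝ x u⟩ = u := by
  have := (trivializationAt E (TangentSpace I : N → Type _) c).continuousLinearMapAt_symmL (R := ℝ)
    (by simpa using hx : x ∈ _) u
  rwa [Bundle.Trivialization.continuousLinearMapAt_apply,
    Bundle.Trivialization.coe_linearMapAt_of_mem _ (by simpa using hx)] at this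

theorem symmL_coord {c x : N} (hx : x ∈ (chartAt H c).source) (v : TangentSpace I x) :
    (trivializationAt E (TangentSpace I : N → Type _) c).symmL ℝ x (coord I c ⟨x, v⟩) = v := by
  have := (trivializationAt E (TangentSpace I : N → Type _) c).symmL_continuousLinearMapAt (R := ℝ)
    (by simpa using hx : x ∈ _) v
  rwa [Bundle.Trivialization.continuousLinearMapAt_apply,
    Bundle.Trivialization.coe_linearMapAt_of_mem _ (by simpa using hx)] at this

theorem coord_linear {c x : N} (hx : x ∈ (chartAt H c).source) :
    IsLinearMap ℝ (fun v : TangentSpace I x => coord I c ⟨x, v⟩) := by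
  constructor
  · intro v w; simp only [coord_eq_mfderiv hx, map_add]; rfl
  · intro r v; simp only [coord_eq_mfderiv hx, map_smul]; rfl

theorem localMetric_coord (g : ∀ x : N, TangentSpace I x →L[ℝ] TangentSpace I x →L[ℝ] ℝ)
    {c x : N} (hx : x ∈ (chartAt H c).source) (v w : TangentSpace I x) :
    localMetric I g c (extChartAt I c x) (coord I c ⟨x, v⟩) (coord I c ⟨x, w⟩) = g x v w := by
  rw [localMetric_apply, (extChartAt I c).left_inv (by simpa using hx), symmL_coord hx,
    symmL_coord hx]

end

end Charts

/-! ### Transition maps, and the metric and curvature in a chart -/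

section CoordinateChange

open Filter Topology

variable {E H : Type*} [NormedAddCommGroup E] [NormedSpace ℝ E] [TopologicalSpace H]
  {I : ModelWithCorners ℝ E H} [I.Boundaryless]
  {N : Type*} [TopologicalSpace N] [ChartedSpace H N]

theorem coord_change [IsManifold I 1 N] {c c' x : N} (hx : x ∈ (chartAt H c).source)
    (hx' : x ∈ (chartAt H c').source) (v : TangentSpace I x) :
    coord I c' ⟨x, v⟩ = fderiv ℝ (extChartAt I c' ∘ (extChartAt I c).symm) (extChartAt I c x)
      (coord I c ⟨x, v⟩) := by
  have h := tangentCoordChange_comp (I := I) (w := x) (x := c) (y := c') (z := x) (v := (v : E))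
    ⟨⟨mem_extChartAt_source x, by simpa using hx⟩, by simpa using hx'⟩
  rw [tangentCoordChange_def (x := c), I.range_eq_univ, fderivWithin_univ] at h
  exact h.symm

theorem contDiffAt_transition [IsManifold I ∞ N] {c c' x : N} (hx : x ∈ (chartAt H c).source)
    (hx' : x ∈ (chartAt H c').source) :
    ContDiffAt ℝ ∞ (extChartAt I c' ∘ (extChartAt I c).symm) (extChartAt I c x) := by
  have hx1 : x ∈ (extChartAt I c).source := by simpa using hx
  have := contDiffWithinAt_ext_coord_change (I := I) (n := ∞) c' c (y := extChartAt I c x)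
    (by
      rw [PartialEquiv.trans_source, Set.mem_inter_iff, PartialEquiv.symm_source,
        Set.mem_preimage, (extChartAt I c).left_inv hx1]
      exact ⟨(extChartAt I c).map_source hx1, by simpa using hx'⟩)
  rwa [I.range_eq_univ, contDiffWithinAt_univ] at this

variable [IsManifold I ∞ N]
  (g : Bundle.ContMDiffRiemannianMetric I ∞ E (fun x : N => TangentSpace I x))

/-- The fields with constant components `u` and `v` in the chart are smooth sections, so the metric
evaluated on them is smooth. -/
theorem contDiffOn_localMetric_apply (c : N) (u v : E) :
    ContDiffOn ℝ ∞ (fun y => localMetric I g.inner c y u v) (extChartAt I c).target := by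
  intro y hy
  have hsymm : ContMDiffAt 𝓘(ℝ, E) I ∞ (extChartAt I c).symm y :=
    (contMDiffOn_extChartAt_symm c).contMDiffAt
      ((isOpen_extChartAt_target c).mem_nhds hy)
  have hx : (extChartAt I c).symm y ∈ (chartAt H c).source := by
    simpa using (extChartAt I c).map_target hy
  have hs (u : E) : ContMDiffAt 𝓘(ℝ, E) (I.prod 𝓘(ℝ, E)) ∞ (fun y => Bundle.TotalSpace.mk' E
      (E := (TangentSpace I : N → Type _)) ((extChartAt I c).symm y)
      ((trivializationAt E (TangentSpace I : N → Type _) c).symmL ℝ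
        ((extChartAt I c).symm y) u)) y := by
    have h1 : ContMDiffAt I (I.prod 𝓘(ℝ, E)) ∞ (fun x => Bundle.TotalSpace.mk' E
        (E := (TangentSpace I : N → Type _)) x
        ((trivializationAt E (TangentSpace I : N → Type _) c).symmL ℝ x u))
        ((extChartAt I c).symm y) := by
      rw [(trivializationAt E (TangentSpace I : N → Type _) c).contMDiffAt_section_iff
        (by simpa using hx)]
      refine (contMDiffAt_const (c := u)).congr_of_eventuallyEq ?_
      filter_upwards [(chartAt H c).open_source.mem_nhds hx] with x hx
      exact coord_symmL hx u
    exact h1.comp y hsymm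
  have key : ContMDiffAt 𝓘(ℝ, E) (I.prod 𝓘(ℝ)) ∞ (fun y => Bundle.TotalSpace.mk' ℝ
      (E := Bundle.Trivial N ℝ) ((extChartAt I c).symm y) (g.inner ((extChartAt I c).symm y)
        ((trivializationAt E (TangentSpace I : N → Type _) c).symmL ℝ
          ((extChartAt I c).symm y) u)
        ((trivializationAt E (TangentSpace I : N → Type _) c).symmL ℝ
          ((extChartAt I c).symm y) v))) y := by
    apply ContMDiffAt.clm_bundle_apply₂ (F₁ := E) (F₂ := E)
    · exact g.contMDiff.contMDiffAt.comp y hsymm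
    · exact hs u
    · exact hs v
  rw [Bundle.contMDiffAt_totalSpace] at key
  exact key.2.contDiffAt.contDiffWithinAt

theorem isMetricOn_localMetric [FiniteDimensional ℝ E] (c : N) :
    IsMetricOn (localMetric I g.inner c) (extChartAt I c).target where
  isOpen := isOpen_extChartAt_target c
  contDiffOn := contDiffOn_clm_apply.2 fun u => contDiffOn_clm_apply.2 fun v =>
    contDiffOn_localMetric_apply g c u v
  symm _ _ _ _ := g.symm _ _ _
  pos y hy u hu := by
    have hx : (extChartAt I c).symm y ∈ (chartAt H c).source := by
      simpa using (extChartAt I c).map_target hy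
    refine g.pos _ _ fun h0 => hu ?_
    have h1 := congrArg (fun v : TangentSpace I ((extChartAt I c).symm y) =>
      coord I c ⟨(extChartAt I c).symm y, v⟩) h0
    exact (coord_symmL (I := I) hx u).symm.trans
      (h1.trans (coord_linear (I := I) hx |>.mk' _ |>.map_zero))

theorem eventually_localMetric_transition {c c' x : N} (hx : x ∈ (chartAt H c).source)
    (hx' : x ∈ (chartAt H c').source) :
    ∀ᶠ y in 𝓝 (extChartAt I c x), ∀ u v, localMetric I g.inner c y u v =
      localMetric I g.inner c' ((extChartAt I c' ∘ (extChartAt I c).symm) y)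
        (fderiv ℝ (extChartAt I c' ∘ (extChartAt I c).symm) y u)
        (fderiv ℝ (extChartAt I c' ∘ (extChartAt I c).symm) y v) := by
  have hx1 : x ∈ (extChartAt I c).source := by simpa using hx
  have hc : ContinuousAt (extChartAt I c).symm (extChartAt I c x) :=
    continuousAt_extChartAt_symm' hx1
  have hev := hc.eventually ((chartAt H c').open_source.mem_nhds
    (by rwa [(extChartAt I c).left_inv hx1]))
  filter_upwards [hev, (isOpen_extChartAt_target (I := I) c).mem_nhds
    ((extChartAt I c).map_source hx1)] with y hy' hy u v
  have hxy : (extChartAt I c).symm y ∈ (chartAt H c).source := by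
    simpa using (extChartAt I c).map_target hy
  have h1 (u : E) := coord_change hxy hy'
    ((trivializationAt E (TangentSpace I : N → Type _) c).symmL ℝ ((extChartAt I c).symm y) u)
  simp only [coord_symmL hxy, (extChartAt I c).right_inv hy] at h1
  rw [← h1, ← h1, Function.comp_apply, localMetric_coord _ hy', localMetric_apply]

/-- `curvature` differentiates `Γ` with `Z` already inserted, whereas `flatCurvature` inserts `Z`
after differentiating. Differentiability of `Γ` makes the two agree. -/
theorem curvature_eq (c : N) (X Y Z : TangentSpace I c) [FiniteDimensional ℝ E] :
    curvature I g.inner c X Y Z =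
      flatCurvature (localMetric I g.inner c) (extChartAt I c c) X Y Z := by
  have hm := isMetricOn_localMetric g c
  have hd := hm.differentiableAt_christoffel (mem_extChartAt_target c)
  have key (X Y Z : E) :
      fderiv ℝ (fun y => flatChristoffel (localMetric I g.inner c) y Z) (extChartAt I c c) X Y =
        fderiv ℝ (flatChristoffel (localMetric I g.inner c)) (extChartAt I c c) X Z Y := by
    rw [(hd.hasFDerivAt.clm_apply (hasFDerivAt_const Z _)).fderiv]
    simp
  have key' (X Y Z : E) :
      fderiv ℝ (fun y => flatChristoffel (localMetric I g.inner c) y Z) (extChartAt I c c) X Y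
        - fderiv ℝ (fun y => flatChristoffel (localMetric I g.inner c) y Z) (extChartAt I c c) Y X
        + flatChristoffel (localMetric I g.inner c) (extChartAt I c c)
          (flatChristoffel (localMetric I g.inner c) (extChartAt I c c) Z Y) X
        - flatChristoffel (localMetric I g.inner c) (extChartAt I c c)
          (flatChristoffel (localMetric I g.inner c) (extChartAt I c c) Z X) Y =
      flatCurvature (localMetric I g.inner c) (extChartAt I c c) X Y Z := by
    rw [key, key]
    rfl
  exact key' X Y Z

end CoordinateChange

/-! ### Covariant derivatives along maps, in an arbitrary chart -/

section CovariantDerivative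

open Filter Topology

variable {E H : Type*} [NormedAddCommGroup E] [NormedSpace ℝ E] [TopologicalSpace H]
  {I : ModelWithCorners ℝ E H} {N : Type*} [TopologicalSpace N] [ChartedSpace H N]
  {E' H' : Type*} [NormedAddCommGroup E'] [NormedSpace ℝ E'] [TopologicalSpace H']
  {J : ModelWithCorners ℝ E' H'} {F : Type*} [TopologicalSpace F] [ChartedSpace H' F]

theorem mdifferentiableAt_extChartAt_comp [IsManifold I 1 N] {c : N} {h : F → N} {p : F}
    (hc : h p ∈ (chartAt H c).source) (hh : MDifferentiableAt J I h p) :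
    MDifferentiableAt J 𝓘(ℝ, E) (fun q => extChartAt I c (h q)) p :=
  (mdifferentiableAt_extChartAt hc).comp p hh

theorem coord_mfderiv [IsManifold I 1 N] {c : N} {h : F → N} {p : F}
    (hc : h p ∈ (chartAt H c).source)
    (hh : MDifferentiableAt J I h p) (u : TangentSpace J p) :
    coord I c ⟨h p, mfderiv J I h p u⟩ = mvfderiv J (fun q => extChartAt I c (h q)) p u := by
  rw [coord_eq_mfderiv hc]
  exact (mfderiv_comp_apply p (mdifferentiableAt_extChartAt hc) hh u).symm

theorem mdifferentiableAt_proj [IsManifold I 1 N] {h : F → N} {V : ∀ q, TangentSpace I (h q)}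
    {p : F}
    (hV : MDifferentiableAt J I.tangent (fun q => (⟨h q, V q⟩ : TangentBundle I N)) p) :
    MDifferentiableAt J I h p :=
  ((mdifferentiableAt_totalSpace _ _).1 hV).1

theorem mdifferentiableAt_coord_self [IsManifold I 1 N] {h : F → N}
    {V : ∀ q, TangentSpace I (h q)} {p : F}
    (hV : MDifferentiableAt J I.tangent (fun q => (⟨h q, V q⟩ : TangentBundle I N)) p) :
    MDifferentiableAt J 𝓘(ℝ, E) (fun q => coord I (h p) ⟨h q, V q⟩) p :=
  ((mdifferentiableAt_totalSpace _ _).1 hV).2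

theorem covDerivAlong_eq [IsManifold I 1 N] [IsManifold J 1 F]
    (g : ∀ x : N, TangentSpace I x →L[ℝ] TangentSpace I x →L[ℝ] ℝ) {h : F → N}
    {V : ∀ q, TangentSpace I (h q)} {p : F} (u : TangentSpace J p) :
    covDerivAlong I g J h V p u = (mvfderiv J (fun q => coord I (h p) ⟨h q, V q⟩) p u
      + flatChristoffel (localMetric I g (h p)) (extChartAt I (h p) (h p)) (V p)
        (mfderiv J I h p u) : E) := rfl

variable [IsManifold I ∞ N]
  (g : Bundle.ContMDiffRiemannianMetric I ∞ E (fun x : N => TangentSpace I x))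

variable [I.Boundaryless]

/-- The coordinate expression of the covariant derivative does not depend on the chart. -/
theorem coord_covDerivAlong [FiniteDimensional ℝ E] [IsManifold J 1 F] {c : N} {h : F → N}
    {V : ∀ q, TangentSpace I (h q)} {p : F} (hc : h p ∈ (chartAt H c).source)
    (hV : MDifferentiableAt J I.tangent (fun q => (⟨h q, V q⟩ : TangentBundle I N)) p)
    (u : TangentSpace J p) :
    coord I c ⟨h p, covDerivAlong I g.inner J h V p u⟩ =
      mvfderiv J (fun q => coord I c ⟨h q, V q⟩) p u
      + flatChristoffel (localMetric I g.inner c) (extChartAt I c (h p)) (coord I c ⟨h p, V p⟩)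
        (mvfderiv J (fun q => extChartAt I c (h q)) p u) := by
  have hh := mdifferentiableAt_proj hV
  have hs : h p ∈ (chartAt H (h p)).source := mem_chart_source H (h p)
  have hx : h p ∈ (extChartAt I (h p)).source := mem_extChartAt_source (h p)
  obtain ⟨τ, hτ⟩ : ∃ τ, τ = extChartAt I c ∘ (extChartAt I (h p)).symm := ⟨_, rfl⟩
  have hτs : ContDiffAt ℝ ∞ τ (extChartAt I (h p) (h p)) := by
    rw [hτ]; exact contDiffAt_transition hs hc
  have hτ0 : τ (extChartAt I (h p) (h p)) = extChartAt I c (h p) := by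
    rw [hτ, Function.comp_apply, (extChartAt I (h p)).left_inv hx]
  have hDτ : DifferentiableAt ℝ (fderiv ℝ τ) (extChartAt I (h p) (h p)) :=
    (hτs.fderiv_right (m := ∞) (by simp)).differentiableAt (by simp)
  have hφ := mdifferentiableAt_extChartAt_comp (J := J) (I := I) hs hh
  have hb := mdifferentiableAt_coord_self hV
  have hA : MDifferentiableAt J 𝓘(ℝ, E →L[ℝ] E)
      (fun q => fderiv ℝ τ (extChartAt I (h p) (h q))) p :=
    DifferentiableAt.comp_mdifferentiableAt (f := fun q => extChartAt I (h p) (h q)) hDτ hφ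
  -- Near `p` the components in the two charts differ by `dτ`. The product rule produces a term in
  -- the second derivative of `τ`, which is the inhomogeneous term in the transformation law of `Γ`.
  have hev : (fun q => coord I c ⟨h q, V q⟩) =ᶠ[𝓝 p]
      fun q => fderiv ℝ τ (extChartAt I (h p) (h q)) (coord I (h p) ⟨h q, V q⟩) := by
    filter_upwards [hh.continuousAt.eventually ((chartAt H (h p)).open_source.mem_nhds hs),
      hh.continuousAt.eventually ((chartAt H c).open_source.mem_nhds hc)] with q h1 h2
    rw [hτ]
    exact coord_change h1 h2 (V q)
  have hev' : (fun q => extChartAt I c (h q)) =ᶠ[𝓝 p] fun q => τ (extChartAt I (h p) (h q)) := by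
    filter_upwards [hh.continuousAt.eventually ((chartAt H (h p)).open_source.mem_nhds hs)]
      with q h1
    rw [hτ, Function.comp_apply, (extChartAt I (h p)).left_inv (by rw [extChartAt_source]; exact h1)]
  have hinv : Function.Surjective (fderiv ℝ τ (extChartAt I (h p) (h p))) := by
    intro w
    refine ⟨coord I (h p) ⟨h p, (trivializationAt E (TangentSpace I : N → Type _) c).symmL ℝ
      (h p) w⟩, ?_⟩
    rw [hτ, ← coord_change hs hc, coord_symmL hc]
  have hmetric := eventually_localMetric_transition g hs hc
  rw [← hτ] at hmetric
  have hΓ := (isMetricOn_localMetric g (h p)).christoffel_pullback (isMetricOn_localMetric g c)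
    (y := extChartAt I (h p) (h p)) (τ := τ) (mem_extChartAt_target (h p))
    (by rw [hτ0]; exact (extChartAt I c).map_source (by simpa using hc))
    (hτs.of_le (by exact ENat.LEInfty.out)) hinv hmetric
  have hdA := mvfderiv_fderiv (a := fun q => extChartAt I (h p) (h q)) hDτ hφ u
  have hdτ := mvfderiv_fderiv (a := fun q => extChartAt I (h p) (h q))
    (hτs.differentiableAt (by simp)) hφ u
  rw [mvfderiv_congr hev, mvfderiv_clm_apply hA hb, hdA, mvfderiv_congr hev',
    hdτ, coord_change hs hc,
    coord_change hs hc (V p), ← hτ, ← coord_mfderiv hs hh, coord_self, coord_self, coord_self,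
    covDerivAlong_eq, map_add]
  have hΓp := hΓ (mfderiv J I h p u) (V p)
  rw [hτ0] at hΓp
  exact (congrArg (fun w : E => _ + w) hΓp).trans (add_assoc _ _ _).symm

end CovariantDerivative

/-! ### The Sasaki metric in the induced charts of the tangent bundle -/

section SasakiCoordinates

open Filter Topology

variable {E H : Type*} [NormedAddCommGroup E] [NormedSpace ℝ E] [TopologicalSpace H]
  {I : ModelWithCorners ℝ E H} {M : Type*} [TopologicalSpace M] [ChartedSpace H M]

theorem extChartAt_tangent_apply [IsManifold I 1 M] (z z' : TangentBundle I M) :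
    extChartAt I.tangent z z' = (extChartAt I z.proj z'.proj, coord I z.proj z') := rfl

variable [IsManifold I ∞ M]

theorem mvfderiv_extChartAt_tangent {z z' : TangentBundle I M}
    (hz : z' ∈ (chartAt (ModelProd H E) z).source) (X : TangentSpace I.tangent z') :
    mvfderiv I.tangent (fun z'' : TangentBundle I M => extChartAt I z.proj z''.proj) z' X =
        (coord I.tangent z ⟨z', X⟩).1 ∧
      mvfderiv I.tangent (fun z'' : TangentBundle I M => coord I z.proj z'') z' X =
        (coord I.tangent z ⟨z', X⟩).2 := by
  have hd : MDifferentiableAt I.tangent 𝓘(ℝ, E × E) (extChartAt I.tangent z) z' :=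
    mdifferentiableAt_extChartAt hz
  have h1 := mvfderiv_fderiv (Φ := Prod.fst) differentiableAt_fst hd X
  have h2 := mvfderiv_fderiv (Φ := Prod.snd) differentiableAt_snd hd X
  rw [fderiv_fst] at h1
  rw [fderiv_snd] at h2
  rw [coord_eq_mfderiv hz]
  exact ⟨h1, h2⟩

theorem coord_projDeriv {z z' : TangentBundle I M}
    (hz : z' ∈ (chartAt (ModelProd H E) z).source) (X : TangentSpace I.tangent z') :
    coord I z.proj ⟨z'.proj, projDeriv I z' X⟩ = (coord I.tangent z ⟨z', X⟩).1 := by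
  have hid : MDifferentiableAt I.tangent I.tangent (fun z'' : TangentBundle I M => z'') z' :=
    mdifferentiableAt_id
  rw [← (mvfderiv_extChartAt_tangent hz X).1]
  exact coord_mfderiv (by simpa using hz) (mdifferentiableAt_proj hid) X

variable [I.Boundaryless] [FiniteDimensional ℝ E]
  (g : Bundle.ContMDiffRiemannianMetric I ∞ E (fun x : M => TangentSpace I x))

/-- `K` is the covariant derivative of the tautological field along the projection, so chart
independence applies directly, also at points `z'` other than the centre `z`. -/
theorem coord_connectionMap {z z' : TangentBundle I M}
    (hz : z' ∈ (chartAt (ModelProd H E) z).source) (X : TangentSpace I.tangent z') :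
    coord I z.proj ⟨z'.proj, connectionMap I g.inner z' X⟩ = (coord I.tangent z ⟨z', X⟩).2
      + flatChristoffel (localMetric I g.inner z.proj) (extChartAt I z.proj z'.proj)
        (coord I z.proj z') (coord I.tangent z ⟨z', X⟩).1 := by
  have hid : MDifferentiableAt I.tangent I.tangent (fun z'' : TangentBundle I M => z'') z' :=
    mdifferentiableAt_id
  rw [← (mvfderiv_extChartAt_tangent hz X).1, ← (mvfderiv_extChartAt_tangent hz X).2]
  exact coord_covDerivAlong g (by simpa using hz) hid X

/-- The coordinate expression of the Sasaki metric. -/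
theorem localMetric_sasaki (z : TangentBundle I M) {w : E × E}
    (hw : w ∈ (extChartAt I.tangent z).target) :
    localMetric I.tangent (sasakiMetric I g.inner) z w =
      flatSasaki (localMetric I g.inner z.proj) w := by
  obtain ⟨z', hz'⟩ : ∃ z', z' = (extChartAt I.tangent z).symm w := ⟨_, rfl⟩
  have hs : z' ∈ (extChartAt I.tangent z).source := by
    rw [hz']; exact (extChartAt I.tangent z).map_target hw
  have hsc : z' ∈ (chartAt (ModelProd H E) z).source := by rwa [extChartAt_source] at hs
  have hsp : z'.proj ∈ (chartAt H z.proj).source := by simpa using hsc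
  obtain rfl : extChartAt I.tangent z z' = w := by
    rw [hz']; exact (extChartAt I.tangent z).right_inv hw
  refine ContinuousLinearMap.ext fun u => ContinuousLinearMap.ext fun v => ?_
  rw [← coord_symmL (I := I.tangent) hsc u, ← coord_symmL (I := I.tangent) hsc v,
    localMetric_coord _ hsc, sasakiMetric_apply, flatSasaki_apply, ← localMetric_coord _ hsp,
    ← localMetric_coord _ hsp, coord_projDeriv hsc, coord_projDeriv hsc,
    coord_connectionMap g hsc, coord_connectionMap g hsc, extChartAt_tangent_apply]

theorem sasakiMetric_eq (z : TangentBundle I M) (u v : TangentSpace I.tangent z) :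
    sasakiMetric I g.inner z u v =
      flatSasaki (localMetric I g.inner z.proj) (extChartAt I.tangent z z) u v := by
  rw [← localMetric_coord _ (mem_chart_source _ z), localMetric_sasaki g z
    (mem_extChartAt_target z), coord_self, coord_self]

theorem flatChristoffel_congr {V : Type*} [NormedAddCommGroup V] [NormedSpace ℝ V]
    {A B : V → V →L[ℝ] V →L[ℝ] ℝ} {y : V}
    (h : A =ᶠ[𝓝 y] B) : flatChristoffel A y = flatChristoffel B y := by
  unfold flatChristoffel
  rw [h.fderiv_eq, h.self_of_nhds]

/-- Christoffel symbols involve a derivative, so equality of the metrics on a neighbourhood is used,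
not only at the point. -/
theorem flatChristoffel_sasaki (z : TangentBundle I M) :
    flatChristoffel (localMetric I.tangent (sasakiMetric I g.inner) z) (extChartAt I.tangent z z) =
      flatChristoffel (flatSasaki (localMetric I g.inner z.proj)) (extChartAt I.tangent z z) := by
  refine flatChristoffel_congr ?_
  filter_upwards [(isOpen_extChartAt_target (I := I.tangent) z).mem_nhds
    (mem_extChartAt_target z)] with w hw using localMetric_sasaki g z hw

end SasakiCoordinates

/-- Two vectors `a`, `b` are the images under `P`, `Q` of a common vector if and only if they are
orthogonal to all pairs of vectors orthogonal to the image of `(P, Q)`. -/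
theorem exists_eq_iff_orthogonal {E W : Type*} [AddCommGroup E] [Module ℝ E]
    [FiniteDimensional ℝ E] [AddCommGroup W] [Module ℝ W] (β : E →ₗ[ℝ] E →ₗ[ℝ] ℝ)
    (hs : ∀ u v, β u v = β v u) (hp : ∀ u, u ≠ 0 → 0 < β u u) (P Q : W →ₗ[ℝ] E)
    (Γ : E → E) (a b : E) :
    (∀ n : E × E, (∀ u, β (P u) n.1 + β (Q u) (n.2 + Γ n.1) = 0) →
      β a n.1 + β b (n.2 + Γ n.1) = 0) ↔ ∃ w, P w = a ∧ Q w = b := by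
  constructor
  · intro h
    let S : LinearMap.BilinForm ℝ (E × E) :=
      β.compl₁₂ (LinearMap.fst ℝ E E) (LinearMap.fst ℝ E E)
        + β.compl₁₂ (LinearMap.snd ℝ E E) (LinearMap.snd ℝ E E)
    have hS (x y : E × E) : S x y = β x.1 y.1 + β x.2 y.2 := rfl
    have hsymm : S.IsSymm := ⟨fun x y => by
      simp [hS, hs y.1, hs y.2]⟩
    have hnn (u : E) : 0 ≤ β u u := by
      rcases eq_or_ne u 0 with rfl | hu
      · simp
      · exact (hp u hu).le
    have hnd : S.Nondegenerate := by
      refine (LinearMap.IsRefl.nondegenerate_iff_separatingLeft hsymm.isRefl).2 ?_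
      intro x hx
      have h0 := hx x
      rw [hS] at h0
      by_contra hne
      rcases eq_or_ne x.1 0 with h1 | h1
      · have h2 : x.2 ≠ 0 := fun h2 => hne (Prod.ext h1 h2)
        linarith [hp _ h2, hnn x.1]
      · linarith [hp _ h1, hnn x.2]
    have key : (a, b) ∈ S.orthogonal (S.orthogonal (LinearMap.range (P.prod Q))) := by
      intro m hm
      -- This choice undoes the shear `(n.1, n.2) ↦ (n.1, n.2 + Γ n.1)`; linearity of `Γ` plays no
      -- role.
      have := h (m.1, m.2 - Γ m.1) fun u => by
        have := hm (P u, Q u) ⟨u, rfl⟩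
        simpa [hS] using this
      change S m (a, b) = 0
      rw [hS, hs, hs m.2]
      simpa using this
    rw [LinearMap.BilinForm.orthogonal_orthogonal hnd hsymm.isRefl] at key
    obtain ⟨w, hw⟩ := key
    exact ⟨w, congrArg Prod.fst hw, congrArg Prod.snd hw⟩
  · rintro ⟨w, rfl, rfl⟩ n hn
    exact hn w

/-! ### The second derivatives of the submanifold `ξ(F)` -/

section TotallyGeodesic

open Filter Topology

set_option maxSynthPendingDepth 3

variable {E H : Type*} [NormedAddCommGroup E] [NormedSpace ℝ E] [TopologicalSpace H]
  {I : ModelWithCorners ℝ E H} {M : Type*} [TopologicalSpace M] [ChartedSpace H M]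
  [IsManifold I ∞ M]
  {E' H' : Type*} [NormedAddCommGroup E'] [NormedSpace ℝ E'] [TopologicalSpace H']
  {J : ModelWithCorners ℝ E' H'} {F : Type*} [TopologicalSpace F] [ChartedSpace H' F]

theorem coord_tangent_mfderiv {f : F → M} {ξ : ∀ q, TangentSpace I (f q)} {z : TangentBundle I M}
    {q : F} (hq : f q ∈ (chartAt H z.proj).source)
    (hξ : MDifferentiableAt J I.tangent (fun q => (⟨f q, ξ q⟩ : TangentBundle I M)) q)
    (u : TangentSpace J q) :
    (coord I.tangent z ⟨⟨f q, ξ q⟩,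
      mfderiv J I.tangent (fun q => (⟨f q, ξ q⟩ : TangentBundle I M)) q u⟩).1 =
        mvfderiv J (fun q => extChartAt I z.proj (f q)) q u ∧
    (coord I.tangent z ⟨⟨f q, ξ q⟩,
      mfderiv J I.tangent (fun q => (⟨f q, ξ q⟩ : TangentBundle I M)) q u⟩).2 =
        mvfderiv J (fun q => coord I z.proj ⟨f q, ξ q⟩) q u := by
  have hz : (⟨f q, ξ q⟩ : TangentBundle I M) ∈ (chartAt (ModelProd H E) z).source := by
    simpa using hq
  have hd := mdifferentiableAt_extChartAt_comp (I := I.tangent)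
    (h := fun q => (⟨f q, ξ q⟩ : TangentBundle I M)) hz hξ
  have h1 := mvfderiv_fderiv (Φ := Prod.fst) differentiableAt_fst hd u
  have h2 := mvfderiv_fderiv (Φ := Prod.snd) differentiableAt_snd hd u
  rw [fderiv_fst] at h1
  rw [fderiv_snd] at h2
  rw [coord_mfderiv (I := I.tangent) (h := fun q => (⟨f q, ξ q⟩ : TangentBundle I M)) hz hξ]
  exact ⟨h1.symm, h2.symm⟩

variable [IsManifold J ∞ F]

/-- The field `ξ_* Y` is the tangent map of `ξ` composed with the section `Y`, both smooth. -/
theorem mdifferentiableAt_mfderiv_field {f : F → M} {ξ : ∀ q, TangentSpace I (f q)}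
    (hξ : ContMDiff J I.tangent ∞ (fun q => (⟨f q, ξ q⟩ : TangentBundle I M)))
    {Y : ∀ q : F, TangentSpace J q} (hY : IsSmoothField J Y) (p : F) :
    MDifferentiableAt J I.tangent.tangent (fun q => (⟨⟨f q, ξ q⟩,
      mfderiv J I.tangent (fun q => (⟨f q, ξ q⟩ : TangentBundle I M)) q (Y q)⟩ :
        TangentBundle I.tangent (TangentBundle I M))) p :=
  (((hξ.contMDiff_tangentMap (m := ∞) (by simp)).comp hY) p).mdifferentiableAt (by simp)

variable [I.Boundaryless] [FiniteDimensional ℝ E]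
  (g : Bundle.ContMDiffRiemannianMetric I ∞ E (fun x : M => TangentSpace I x))

theorem sasakiMetric_eq_of_components (z : TangentBundle I M) (U n : E × E) {a b : E}
    (ha : U.1 = a) (hb : U.2 + flatChristoffel (localMetric I g.inner z.proj)
      (extChartAt I z.proj z.proj) z.snd U.1 = b) :
    sasakiMetric I g.inner z U n =
      localMetric I g.inner z.proj (extChartAt I z.proj z.proj) a n.1
      + localMetric I g.inner z.proj (extChartAt I z.proj z.proj) b
        (n.2 + flatChristoffel (localMetric I g.inner z.proj)
          (extChartAt I z.proj z.proj) z.snd n.1) := by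
  subst ha hb
  have h := sasakiMetric_eq g z U n
  rw [extChartAt_tangent_apply] at h
  have hz : coord I z.proj z = z.snd := coord_self z.proj z.snd
  rw [hz] at h
  exact h

/-- The tangent vector `ξ_* u` has horizontal part `f_* u` and vertical part `∇_u ξ`. -/
theorem sasakiMetric_mfderiv {f : F → M} {ξ : ∀ q, TangentSpace I (f q)} {p : F}
    (hξ : MDifferentiableAt J I.tangent (fun q => (⟨f q, ξ q⟩ : TangentBundle I M)) p)
    (u : TangentSpace J p) (n : E × E) :
    sasakiMetric I g.inner ⟨f p, ξ p⟩
        (mfderiv J I.tangent (fun q => (⟨f q, ξ q⟩ : TangentBundle I M)) p u) n =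
      localMetric I g.inner (f p) (extChartAt I (f p) (f p)) (mfderiv J I f p u) n.1
      + localMetric I g.inner (f p) (extChartAt I (f p) (f p)) (covDerivAlong I g.inner J f ξ p u)
        (n.2 + flatChristoffel (localMetric I g.inner (f p)) (extChartAt I (f p) (f p))
          (ξ p) n.1) := by
  have hs := mem_chart_source H (f p)
  have h := coord_tangent_mfderiv (z := ⟨f p, ξ p⟩) hs hξ u
  rw [coord_self, ← coord_mfderiv hs (mdifferentiableAt_proj hξ), coord_self] at h
  refine sasakiMetric_eq_of_components g ⟨f p, ξ p⟩ _ n h.1 ?_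
  rw [covDerivAlong_eq]
  exact congrArg₂ (fun v w : E => v + flatChristoffel (localMetric I g.inner (f p))
    (extChartAt I (f p) (f p)) (ξ p) w) h.2 h.1

/-- The Levi-Civita connection of the Sasaki metric along the submanifold defined by a vector
field. -/
theorem sasakiMetric_covDerivAlong {f : F → M} {ξ : ∀ q, TangentSpace I (f q)}
    (hξ : ContMDiff J I.tangent ∞ (fun q => (⟨f q, ξ q⟩ : TangentBundle I M)))
    (X : ∀ q : F, TangentSpace J q)
    {Y : ∀ q : F, TangentSpace J q} (hY : IsSmoothField J Y) (p : F) (n : E × E) :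
    sasakiMetric I g.inner ⟨f p, ξ p⟩
        (covDerivAlong I.tangent (sasakiMetric I g.inner) J
          (fun q => (⟨f q, ξ q⟩ : TangentBundle I M)) (fun q => mfderiv J I.tangent
            (fun q => (⟨f q, ξ q⟩ : TangentBundle I M)) q (Y q)) p (X p)) n =
      localMetric I g.inner (f p) (extChartAt I (f p) (f p)) (xiDeriv I g.inner J f ξ X Y p) n.1
      + localMetric I g.inner (f p) (extChartAt I (f p) (f p))
        (covDerivAlong I g.inner J f (fun q => covDerivAlong I g.inner J f ξ q (Y q)) p (X p)
          - (1 / 2 : ℝ) • curvature I g.inner (f p) (mfderiv J I f p (X p))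
            (mfderiv J I f p (Y p)) (ξ p) : E)
        (n.2 + flatChristoffel (localMetric I g.inner (f p)) (extChartAt I (f p) (f p))
          (ξ p) n.1) := by
  have hξd (q : F) : MDifferentiableAt J I.tangent
      (fun q => (⟨f q, ξ q⟩ : TangentBundle I M)) q := (hξ q).mdifferentiableAt (by simp)
  have hfd (q : F) : MDifferentiableAt J I f q := mdifferentiableAt_proj (hξd q)
  have hs := mem_chart_source H (f p)
  have hmem := mem_extChartAt_target (I := I) (f p)
  have hm := isMetricOn_localMetric g (f p)
  have hev : ∀ᶠ q in 𝓝 p, f q ∈ (chartAt H (f p)).source :=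
    (hfd p).continuousAt.eventually ((chartAt H (f p)).open_source.mem_nhds hs)
  obtain ⟨B, hB⟩ : ∃ B, B = localMetric I g.inner (f p) := ⟨_, rfl⟩
  obtain ⟨y, hy⟩ : ∃ y, y = extChartAt I (f p) (f p) := ⟨_, rfl⟩
  rw [← hB] at hm
  rw [← hy] at hmem
  -- the coordinates of `dξ (Y)`
  obtain ⟨A, hA⟩ : ∃ A : F → E × E, A = fun q => coord I.tangent
      (⟨f p, ξ p⟩ : TangentBundle I M) ⟨(⟨f q, ξ q⟩ : TangentBundle I M),
      mfderiv J I.tangent (fun q => (⟨f q, ξ q⟩ : TangentBundle I M)) q (Y q)⟩ := ⟨_, rfl⟩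
  have hAd : MDifferentiableAt J 𝓘(ℝ, E × E) A p := by
    rw [hA]
    exact mdifferentiableAt_coord_self (I := I.tangent)
      (h := fun q => (⟨f q, ξ q⟩ : TangentBundle I M))
      (V := fun q => mfderiv J I.tangent (fun q => (⟨f q, ξ q⟩ : TangentBundle I M)) q (Y q))
      (mdifferentiableAt_mfderiv_field hξ hY p)
  have hA1 : ∀ᶠ q in 𝓝 p, (A q).1 = mvfderiv J (fun q => extChartAt I (f p) (f q)) q (Y q) := by
    filter_upwards [hev] with q hq
    rw [hA]
    exact (coord_tangent_mfderiv (z := ⟨f p, ξ p⟩) hq (hξd q) (Y q)).1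
  have hA2 : ∀ᶠ q in 𝓝 p, (A q).2 = mvfderiv J (fun q => coord I (f p) ⟨f q, ξ q⟩) q (Y q) := by
    filter_upwards [hev] with q hq
    rw [hA]
    exact (coord_tangent_mfderiv (z := ⟨f p, ξ p⟩) hq (hξd q) (Y q)).2
  obtain ⟨D, hD⟩ : ∃ D : E × E, D = mvfderiv J A p (X p) := ⟨_, rfl⟩
  have hD1 : mvfderiv J (fun q => (A q).1) p (X p) = D.1 := by
    rw [hD, mvfderiv_fderiv (Φ := Prod.fst) differentiableAt_fst hAd, fderiv_fst]; rfl
  have hD2 : mvfderiv J (fun q => (A q).2) p (X p) = D.2 := by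
    rw [hD, mvfderiv_fderiv (Φ := Prod.snd) differentiableAt_snd hAd, fderiv_snd]; rfl
  have hA1d : MDifferentiableAt J 𝓘(ℝ, E) (fun q => (A q).1) p :=
    DifferentiableAt.comp_mdifferentiableAt (g := Prod.fst) differentiableAt_fst hAd
  have hA2d : MDifferentiableAt J 𝓘(ℝ, E) (fun q => (A q).2) p :=
    DifferentiableAt.comp_mdifferentiableAt (g := Prod.snd) differentiableAt_snd hAd
  -- the coordinates of `dξ (X)` at `p`
  obtain ⟨x₁, hx₁⟩ : ∃ x : E, x = mfderiv J I f p (X p) := ⟨_, rfl⟩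
  obtain ⟨x₂, hx₂⟩ : ∃ x : E, x = mvfderiv J (fun q => coord I (f p) ⟨f q, ξ q⟩) p (X p) :=
    ⟨_, rfl⟩
  obtain ⟨η, hη⟩ : ∃ η : E, η = ξ p := ⟨_, rfl⟩
  have hx₁' : mvfderiv J (fun q => extChartAt I (f p) (f q)) p (X p) = x₁ := by
    rw [hx₁, ← coord_mfderiv hs (hfd p), coord_self]
  have hY₁ : (mfderiv J I f p (Y p) : E) = (A p).1 := by
    rw [hA1.self_of_nhds, ← coord_mfderiv hs (hfd p), coord_self]
  have hφd := mdifferentiableAt_extChartAt_comp (J := J) (I := I) hs (hfd p)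
  have hcd := mdifferentiableAt_coord_self (hξd p)
  -- the covariant derivatives in coordinates
  have hξX : (covDerivAlong I g.inner J f ξ p (X p) : E) = x₂ + flatChristoffel B y η x₁ := by
    rw [covDerivAlong_eq, hx₂, hx₁, hη, hB, hy]
  have hξY : (covDerivAlong I g.inner J f ξ p (Y p) : E)
      = (A p).2 + flatChristoffel B y η (A p).1 := by
    rw [covDerivAlong_eq, hA2.self_of_nhds, ← hY₁, hη, hB, hy]
  have hfY : (covDerivAlong I g.inner J f (fun q => mfderiv J I f q (Y q)) p (X p) : E)
      = D.1 + flatChristoffel B y (A p).1 x₁ := by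
    have h1 : (fun q => coord I (f p) ⟨f q, mfderiv J I f q (Y q)⟩) =ᶠ[𝓝 p] fun q => (A q).1 := by
      filter_upwards [hev, hA1] with q hq hq1
      rw [hq1, coord_mfderiv hq (hfd q)]
    rw [covDerivAlong_eq, mvfderiv_congr h1, hD1, ← hY₁, hx₁, hB, hy]
  have hξYX : (covDerivAlong I g.inner J f (fun q => covDerivAlong I g.inner J f ξ q (Y q)) p
      (X p) : E) = D.2 + (fderiv ℝ (flatChristoffel B) y x₁ η (A p).1
        + flatChristoffel B y x₂ (A p).1 + flatChristoffel B y η D.1)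
        + flatChristoffel B y ((A p).2 + flatChristoffel B y η (A p).1) x₁ := by
    -- The inner derivative at `q` is defined in the chart at `f q`, which moves with `q`. It must
    -- be rewritten in the fixed chart at `f p` before it is differentiated.
    have h1 : (fun q => coord I (f p) ⟨f q, covDerivAlong I g.inner J f ξ q (Y q)⟩) =ᶠ[𝓝 p]
        fun q => (A q).2 + flatChristoffel B (extChartAt I (f p) (f q))
          (coord I (f p) ⟨f q, ξ q⟩) (A q).1 := by
      filter_upwards [hev, hA1, hA2] with q hq hq1 hq2
      rw [coord_covDerivAlong g hq (hξd q), hq1, hq2, hB]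
    have hΓ : DifferentiableAt ℝ (flatChristoffel B) (extChartAt I (f p) (f p)) := by
      rw [← hy]; exact hm.differentiableAt_christoffel hmem
    have hΓd : MDifferentiableAt J 𝓘(ℝ, E →L[ℝ] E →L[ℝ] E)
        (fun q => flatChristoffel B (extChartAt I (f p) (f q))) p :=
      DifferentiableAt.comp_mdifferentiableAt (g := flatChristoffel B)
        (f := fun q => extChartAt I (f p) (f q)) hΓ hφd
    have hdΓ := mvfderiv_fderiv (a := fun q => extChartAt I (f p) (f q)) hΓ hφd (X p)
    have hΓξd := hΓd.clm_apply hcd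
    have hc : coord I (f p) ⟨f p, ξ p⟩ = η := by rw [coord_self, hη]
    rw [covDerivAlong_eq, mvfderiv_congr h1, mvfderiv_add hA2d (hΓξd.clm_apply hA1d),
      mvfderiv_clm_apply hΓξd hA1d, mvfderiv_clm_apply hΓd hcd, hdΓ, hD1, hD2, hx₁', ← hx₂, hc,
      ← hy, ← hx₁, ← hB, hξY]
    simp only [add_apply]
    abel
  have hAp : A p = mfderiv J I.tangent (fun q => (⟨f q, ξ q⟩ : TangentBundle I M)) p (Y p) := by
    rw [hA]; exact coord_self (I := I.tangent) (⟨f p, ξ p⟩ : TangentBundle I M) _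
  have hXp : (mfderiv J I.tangent (fun q => (⟨f q, ξ q⟩ : TangentBundle I M)) p (X p) : E × E)
      = (x₁, x₂) := by
    have h := coord_tangent_mfderiv (z := ⟨f p, ξ p⟩) hs (hξd p) (X p)
    rw [coord_self, hx₁', ← hx₂] at h
    exact Prod.ext h.1 h.2
  have hext : extChartAt I.tangent (⟨f p, ξ p⟩ : TangentBundle I M) ⟨f p, ξ p⟩ = (y, η) := by
    rw [extChartAt_tangent_apply, coord_self, hη, hy]
  have hcov : (covDerivAlong I.tangent (sasakiMetric I g.inner) J
          (fun q => (⟨f q, ξ q⟩ : TangentBundle I M)) (fun q => mfderiv J I.tangent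
            (fun q => (⟨f q, ξ q⟩ : TangentBundle I M)) q (Y q)) p (X p) : E × E) =
      D + flatChristoffel (flatSasaki B) (y, η) (A p) (x₁, x₂) := by
    have h1 := flatChristoffel_sasaki g ⟨f p, ξ p⟩
    rw [hext, ← hB] at h1
    have h2 : flatChristoffel (localMetric I.tangent (sasakiMetric I g.inner) ⟨f p, ξ p⟩)
        (y, η) (A p) (x₁, x₂) =
          flatChristoffel (flatSasaki B) (y, η) (A p) (x₁, x₂) :=
      congrArg (fun L : E × E →L[ℝ] E × E →L[ℝ] E × E => L (A p) (x₁, x₂)) h1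
    rw [← h2, ← hext, hD, ← hXp, hAp, hA]
    rfl
  obtain ⟨Z, hZ⟩ : ∃ Z, Z = flatChristoffel (flatSasaki B) (y, η) (A p) (x₁, x₂) := ⟨_, rfl⟩
  have hSZ : sasakiMetric I g.inner ⟨f p, ξ p⟩ Z n = flatSasaki B (y, η) Z n := by
    have h1 := sasakiMetric_eq g ⟨f p, ξ p⟩ Z n
    rw [hext, ← hB] at h1
    exact h1
  have hSD : sasakiMetric I g.inner ⟨f p, ξ p⟩ D n = flatSasaki B (y, η) D n := by
    have h1 := sasakiMetric_eq g ⟨f p, ξ p⟩ D n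
    rw [hext, ← hB] at h1
    exact h1
  have hsum (S : E × E →L[ℝ] E × E →L[ℝ] ℝ) : S (D + Z) n = S D n + S Z n := by simp
  have hL : sasakiMetric I g.inner ⟨f p, ξ p⟩
        (covDerivAlong I.tangent (sasakiMetric I g.inner) J
          (fun q => (⟨f q, ξ q⟩ : TangentBundle I M)) (fun q => mfderiv J I.tangent
            (fun q => (⟨f q, ξ q⟩ : TangentBundle I M)) q (Y q)) p (X p)) n =
      flatSasaki B (y, η) D n + flatSasaki B (y, η) Z n := by
    rw [← hSZ, ← hSD]
    exact (congrArg (fun U : E × E => sasakiMetric I g.inner ⟨f p, ξ p⟩ U n)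
      (hcov.trans (by rw [hZ]))).trans (hsum (sasakiMetric I g.inner ⟨f p, ξ p⟩))
  have hxi : (xiDeriv I g.inner J f ξ X Y p : E) = D.1 + flatChristoffel B y (A p).1 x₁
      + (1 / 2 : ℝ) • (flatCurvature B y η (x₂ + flatChristoffel B y η x₁) (A p).1
        + flatCurvature B y η ((A p).2 + flatChristoffel B y η (A p).1) x₁) := by
    rw [← hξX, ← hξY, ← hfY, ← hY₁, hx₁, hη, hB, hy]
    unfold xiDeriv
    rw [curvature_eq, curvature_eq]
    rfl
  have hR : (curvature I g.inner (f p) (mfderiv J I f p (X p)) (mfderiv J I f p (Y p)) (ξ p) : E)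
      = flatCurvature B y x₁ (A p).1 η := by
    rw [curvature_eq, ← hY₁, hx₁, hη, hB, hy]
  have hlin (a₁ a₂ a₃ b₁ b₂ b₃ m k : E) (ha : a₁ + a₂ = a₃) (hb : b₁ + b₂ = b₃) :
      B y a₁ m + B y b₁ k + (B y a₂ m + B y b₂ k) = B y a₃ m + B y b₃ k := by
    rw [← ha, ← hb, map_add, map_add]
    simp only [add_apply]
    ring
  have hadd (a b c d e r : E) : a + b + (c + (d + e) - r) = a + (d + e + b) + c - r := by abel
  rw [hL, ← hB, ← hy, hxi, hξYX, hR, flatSasaki_apply, hZ, hm.flatSasaki_christoffel hmem, ← hη]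
  exact hlin _ _ _ _ _ _ _ _ (add_assoc _ _ _).symm (hadd _ _ _ _ _ _)

/-- The submanifold defined by a vector field is totally geodesic for the Sasaki metric if and only
if its second derivatives are tangent to it. -/
theorem isTotallyGeodesic_sasaki_iff {f : F → M} {ξ : ∀ q, TangentSpace I (f q)}
    (hξ : ContMDiff J I.tangent ∞ (fun q => (⟨f q, ξ q⟩ : TangentBundle I M))) :
    IsTotallyGeodesic I.tangent (sasakiMetric I g.inner) J
        (fun p => (⟨f p, ξ p⟩ : TangentBundle I M)) ↔
      ∀ X Y : ∀ p : F, TangentSpace J p, IsSmoothField J X → IsSmoothField J Y →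
        ∀ p : F, ∃ w : TangentSpace J p,
          mfderiv J I f p w = xiDeriv I g.inner J f ξ X Y p ∧
          covDerivAlong I g.inner J f ξ p w =
            covDerivAlong I g.inner J f (fun q => covDerivAlong I g.inner J f ξ q (Y q)) p (X p)
              - (1 / 2 : ℝ) • curvature I g.inner (f p) (mfderiv J I f p (X p))
                (mfderiv J I f p (Y p)) (ξ p) := by
  unfold IsTotallyGeodesic
  refine forall_congr' fun X => forall_congr' fun Y => forall_congr' fun _ =>
    forall_congr' fun hY => forall_congr' fun p => ?_
  have hm := isMetricOn_localMetric g (f p)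
  have hmem := mem_extChartAt_target (I := I) (f p)
  -- Here `P = f_*` and `Q = ∇ξ`. The shear by `Γ(ξ p)` converts the coordinates of a normal vector
  -- `n` into its horizontal and vertical parts, and `n` ranges over all of `E × E`.
  have key := exists_eq_iff_orthogonal (W := TangentSpace J p)
    (ContinuousLinearMap.coeLM ℝ ∘ₗ
      (localMetric I g.inner (f p) (extChartAt I (f p) (f p))).toLinearMap)
    (hm.symm _ hmem) (hm.pos _ hmem)
    (mfderiv J I f p : TangentSpace J p →L[ℝ] E).toLinearMap
    (covDerivAlong I g.inner J f ξ p : TangentSpace J p →L[ℝ] E).toLinearMap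
    (flatChristoffel (localMetric I g.inner (f p)) (extChartAt I (f p) (f p)) (ξ p))
    (xiDeriv I g.inner J f ξ X Y p)
    (covDerivAlong I g.inner J f (fun q => covDerivAlong I g.inner J f ξ q (Y q)) p (X p)
      - (1 / 2 : ℝ) • curvature I g.inner (f p) (mfderiv J I f p (X p))
        (mfderiv J I f p (Y p)) (ξ p) : E)
  refine Iff.trans (forall_congr' fun n => ?_) key
  refine imp_congr (forall_congr' fun u => ?_) ?_
  · exact Eq.congr (sasakiMetric_mfderiv g ((hξ p).mdifferentiableAt (by simp)) u n) rfl
  · exact Eq.congr (sasakiMetric_covDerivAlong g hξ X hY p n) rfl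

end TotallyGeodesic

end SasakiGeometry

end

theorem proposition5 {n l : ℕ}
    {M : Type*} [TopologicalSpace M] [T2Space M]
    [ChartedSpace (EuclideanSpace ℝ (Fin n)) M] [IsManifold (𝓡 n) ∞ M]
    -- the Riemannian metric of `M`
    (g : Bundle.ContMDiffRiemannianMetric (𝓡 n) ∞ (EuclideanSpace ℝ (Fin n))
      (fun x : M => TangentSpace (𝓡 n) x))
    {F : Type*} [TopologicalSpace F] [T2Space F]
    [ChartedSpace (EuclideanSpace ℝ (Fin l)) F] [IsManifold (𝓡 l) ∞ F]
    -- `F` is a submanifold of `M`, immersed by `f`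
    (f : F → M) (hf : ContMDiff (𝓡 l) (𝓡 n) ∞ f)
    (hf_imm : ∀ p : F, Function.Injective (mfderiv (𝓡 l) (𝓡 n) f p))
    -- `ξ` is a smooth vector field on `M` along `F`
    (ξ : ∀ p : F, TangentSpace (𝓡 n) (f p))
    (hξ : ContMDiff (𝓡 l) (𝓡 n).tangent ∞ (fun p => (⟨f p, ξ p⟩ : TangentBundle (𝓡 n) M))) :
    -- `ξ(F)` is totally geodesic in `TM` with the Sasaki metric
    SasakiGeometry.IsTotallyGeodesic (𝓡 n).tangent
        (SasakiGeometry.sasakiMetric (𝓡 n) g.inner) (𝓡 l)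
        (fun p => (⟨f p, ξ p⟩ : TangentBundle (𝓡 n) M)) ↔
      -- (a) `F` is totally geodesic for the `ξ`-connection
      SasakiGeometry.IsXiTotallyGeodesic (𝓡 n) g.inner (𝓡 l) f ξ ∧
      -- (b) `∇_X ∇_Y ξ = ∇_{∇*_X Y} ξ + R(X, Y) ξ / 2`; here `w` is the value of `∇*_X Y`,
      -- seen as a tangent vector of `F`
      ∀ X Y : ∀ p : F, TangentSpace (𝓡 l) p,
        SasakiGeometry.IsSmoothField (𝓡 l) X → SasakiGeometry.IsSmoothField (𝓡 l) Y →
        ∀ (p : F) (w : TangentSpace (𝓡 l) p),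
          mfderiv (𝓡 l) (𝓡 n) f p w = SasakiGeometry.xiDeriv (𝓡 n) g.inner (𝓡 l) f ξ X Y p →
          SasakiGeometry.covDerivAlong (𝓡 n) g.inner (𝓡 l) f
              (fun q => SasakiGeometry.covDerivAlong (𝓡 n) g.inner (𝓡 l) f ξ q (Y q)) p (X p) =
            SasakiGeometry.covDerivAlong (𝓡 n) g.inner (𝓡 l) f ξ p w
              + (1 / 2 : ℝ) • SasakiGeometry.curvature (𝓡 n) g.inner (f p)
                  (mfderiv (𝓡 l) (𝓡 n) f p (X p)) (mfderiv (𝓡 l) (𝓡 n) f p (Y p)) (ξ p) := by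
  rw [SasakiGeometry.isTotallyGeodesic_sasaki_iff g hξ]
  constructor
  · intro h
    refine ⟨fun X Y hX hY p => ?_, fun X Y hX hY p w hw => ?_⟩
    · obtain ⟨w, hw, -⟩ := h X Y hX hY p
      exact ⟨w, hw⟩
    · obtain ⟨w', hw', hξw⟩ := h X Y hX hY p
      -- The `w` of condition (b) is an arbitrary preimage of `∇*_X Y`; injectivity of `f_*`
      -- identifies it with the one provided by total geodesy.
      rw [hf_imm p (hw.trans hw'.symm), hξw, sub_add_cancel]
  · rintro ⟨ha, hb⟩ X Y hX hY p
    obtain ⟨w, hw⟩ := ha X Y hX hY p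
    exact ⟨w, hw, eq_sub_of_add_eq (hb X Y hX hY p w hw).symm⟩
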